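/- Let $[q]=\{1,\dots,q\}$. For two probability mass functions on a finite set put $\Delta_{TV}(P,Q)=\frac12\sum_x|P(x)-Q(x)|$. **Likelihood ratios.** For distributions $P,Q$ on a discrete space let $(P\|Q)$ be the law of $P(X)/Q(X)$ for $X\sim Q$, a distribution on $[0,\infty)$. For a finitely supported ratio $R$ let $\Delta_{TV}(R)=\mathbb E_{X\sim R}\max(1-X,0)$, and let $R^\dagger$ be the distribution on $[0,\infty]$ with $R^\dagger(r)=r\,R(r)$ for $r<\infty$ and $R^\dagger(\infty)=1-\mathbb E_{X\sim R}[X]$. Let $R\cdot S$ be the law of $XY$ for independent $X\sim R$, $Y\sim S$. For $\epsilon>0$, $\delta\ge 0$ put $m=\max(0,\lceil-\log\delta/\log(1+\epsilon)\rceil)$ (and $m=0$ if $\delta=0$), $a_t=1-(1+\epsilon)^{-t}$, and partition $[0,\infty]$ into $I_t=[a_t,a_{t+1})$ $(t<m)$, $I_m=[a_m,1)$, $\{1\}$, $J_m=(1,1/a_m]$, $J_t=(1/a_{t+1},1/a_t]$ $(t<m)$, where $1/0=\infty$. Let $\mathsf{Sparsify}(R,\epsilon,\delta)=(\kappa R^\dagger\|\kappa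 R)$, where $\kappa$ collapses each set of this partition to one point. **Algorithm.** The input consists of integers $n\ge1$ and $q$, distributions $P_1,\dots,P_n,Q_1,\dots,Q_n$ on $[q]$, and $\varepsilon>0$. Put $R_i=(P_i\|Q_i)$, $d=\max_i\Delta_{TV}(P_i,Q_i)$, $R'_{1}=R_1$, and for $k=1,\dots,n-1$ put $$R'_{k+1}=\mathsf{Sparsify}\bigl(R'_{k},\tfrac{\varepsilon}{2n},\tfrac{\varepsilon}{2n}d\bigr)\cdot R_{k+1}.$$ The output is $\widehat\Delta=\Delta_{TV}(R'_n)$. **Machine model.** The machine is a deterministic real RAM: it has natural-number index registers (constants, addition, truncated subtraction, comparison), real registers (natural-number constants, $+,-,\times,\div$, comparison), and arrays of real numbers addressed through index registers. Each elementary operation or test costs one step. There are no roundings, logarithms or conversions between reals and indices. The input is given by $n$, $q$, $\varepsilon$ and the two $n\times q$ tables of marginal probabilities. **Theorem.** There are a single program for this machine and a constant $C$ such that for all $n\ge1$, $q$, $P_i$, $Q_i$ and $\varepsilon>0$ as above, with $P=P_1\times\dots\times P_n$ and $Q=Q_1\times\dots\times Q_n$, the program halts, outputs the number $\widehat\Delta$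 computed by the algorithm above, and $$(1-\varepsilon)\,\Delta_{TV}(P,Q)\le\widehat\Delta\le\Delta_{TV}(P,Q).$$ If moreover $\Delta_{TV}(P,Q)>0$, then with $\bar\varepsilon=\min(\varepsilon,1)$ the number of steps is at most $$C\cdot\frac{q n^2}{\bar\varepsilon}\cdot\log q\cdot\log\frac{2n}{\bar\varepsilon\,\Delta_{TV}(P,Q)} .$$ -/

import Mathlib

open scoped ENNReal

namespace TVProduct

noncomputable section

/-! ### Total variation distance and product distributions -/

/-- The total variation distance `(1/2) ∑ |P x - Q x|` of two distributions on a finite sample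
space, given by their probability mass functions. -/
def tvDist {Ω : Type*} [Fintype Ω] (P Q : Ω → ℝ) : ℝ :=
  (1 / 2) * ∑ x, |P x - Q x|

/-- The probability mass function of the product distribution on `[q]^n` whose `i`-th marginal
is `P i`. -/
def prodDist {n q : ℕ} (P : Fin n → Fin q → ℝ) (x : Fin n → Fin q) : ℝ :=
  ∏ i, P i (x i)

/-! ### Likelihood ratio distributions

A distribution with finite support on `Ω` is represented by its mass function `Ω →₀ ℝ`; a ratio
is a distribution with finite support on `[0, ∞)`, represented by `ℝ →₀ ℝ`. -/

/-- The likelihood ratio distribution `(P ‖ Q)`: the law of `P X / Q X` for `X` drawn from `Q`. -/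
def ratio {Ω : Type*} (P Q : Ω →₀ ℝ) : ℝ →₀ ℝ :=
  Q.sum fun x p => Finsupp.single (P x / p) p

/-- The likelihood ratio distribution of two distributions on a finite sample space. -/
def ratioFin {q : ℕ} (P Q : Fin q → ℝ) : ℝ →₀ ℝ :=
  ratio (Finsupp.equivFunOnFinite.symm P) (Finsupp.equivFunOnFinite.symm Q)

/-- The law of `X * Y` for independent `X`, `Y` with laws `R` and `S`. -/
def mulIndep (R S : ℝ →₀ ℝ) : ℝ →₀ ℝ :=
  R.sum fun r p => S.sum fun s t => Finsupp.single (r * s) (p * t)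

/-- The total variation distance `E max (1 - R, 0)` encoded by a ratio. -/
def tvRatio (R : ℝ →₀ ℝ) : ℝ :=
  R.sum fun r p => max (1 - r) 0 * p

/-- The ratio `R` itself, seen as a distribution on `[0, ∞]`. -/
def extend (R : ℝ →₀ ℝ) : ℝ≥0∞ →₀ ℝ :=
  R.mapDomain ENNReal.ofReal

/-- The alternative ratio of `R`: the distribution on `[0, ∞]` with mass `r * R r` at every
finite `r` and mass `1 - E R` at `∞`. -/
def dagger (R : ℝ →₀ ℝ) : ℝ≥0∞ →₀ ℝ :=
  (R.sum fun r p => Finsupp.single (ENNReal.ofReal r) (r * p)) +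
    Finsupp.single ⊤ (1 - R.sum fun r p => r * p)

/-! ### Sparsification -/

open Classical in
/-- The deterministic kernel that collapses each `I t` to one point `ω_t = Sum.inl t` and leaves
all other points of `[0, ∞]` alone. -/
def collapse {ι : Type*} (I : ι → Set ℝ≥0∞) (r : ℝ≥0∞) : ι ⊕ ℝ≥0∞ :=
  if h : ∃ t, r ∈ I t then Sum.inl h.choose else Sum.inr r

/-- Sparsification of `R` with respect to a family of disjoint intervals: the ratio of the images
of the canonical pair of `R` under the collapsing kernel. -/
def sparsifyWrtIntervals {ι : Type*} (R : ℝ →₀ ℝ) (I : ι → Set ℝ≥0∞) : ℝ →₀ ℝ :=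
  ratio ((dagger R).mapDomain (collapse I)) ((extend R).mapDomain (collapse I))

/-- Names for the intervals `I_0, …, I_m, {1}, J_m, …, J_0`. -/
inductive IntervalIndex (m : ℕ) : Type
  | low (t : Fin (m + 1))
  | one
  | high (t : Fin (m + 1))

/-- The breakpoint `a_t = 1 - (1 + ε)^(-t)`, as an element of `[0, ∞]`. -/
def breakpoint (ε : ℝ) (t : ℕ) : ℝ≥0∞ :=
  ENNReal.ofReal (1 - ((1 + ε) ^ t)⁻¹)

/-- The number `m = ⌈-log δ / log (1 + ε)⌉` (it is `0` if `1 ≤ δ`). -/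
def numIntervals (ε δ : ℝ) : ℕ :=
  ⌈-Real.log δ / Real.log (1 + ε)⌉₊

/-- The intervals `I_t = [a_t, a_{t+1})` for `t < m`, `I_m = [a_m, 1)`, the point `{1}`, and
`J_t = (1 / a_{t+1}, 1 / a_t]` for `t < m`, `J_m = (1, 1 / a_m]`, where `1 / 0 = ∞`. -/
def intervals (ε : ℝ) (m : ℕ) : IntervalIndex m → Set ℝ≥0∞
  | .low t =>
      if (t : ℕ) < m then Set.Ico (breakpoint ε t) (breakpoint ε (t + 1))
      else Set.Ico (breakpoint ε m) 1
  | .one => {1}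
  | .high t =>
      if (t : ℕ) < m then Set.Ioc (breakpoint ε (t + 1))⁻¹ (breakpoint ε t)⁻¹
      else Set.Ioc 1 (breakpoint ε m)⁻¹

/-- The procedure `Sparsify (R, ε, δ)`. -/
def sparsify (R : ℝ →₀ ℝ) (ε δ : ℝ) : ℝ →₀ ℝ :=
  sparsifyWrtIntervals R (intervals ε (numIntervals ε δ))

/-! ### The approximation algorithm for product distributions, as a mathematical function -/

/-- The lower bound `max_i Δ_TV (P_i, Q_i)`. -/
def lowerBound {n q : ℕ} (P Q : Fin n → Fin q → ℝ) : ℝ :=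
  ⨆ i, tvDist (P i) (Q i)

/-- The ratio `R'_{1:k+1}` after `k` rounds of sparsifying and multiplying by the next ratio
(coordinates are numbered from `0`). -/
def approxRatio {n q : ℕ} (P Q : Fin n → Fin q → ℝ) (ε : ℝ) : (k : ℕ) → k < n → (ℝ →₀ ℝ)
  | 0, h => ratioFin (P ⟨0, h⟩) (Q ⟨0, h⟩)
  | k + 1, h =>
      mulIndep
        (sparsify (approxRatio P Q ε k (Nat.lt_of_succ_lt h))
          (ε / (2 * n)) (ε / (2 * n) * lowerBound P Q))
        (ratioFin (P ⟨k + 1, h⟩) (Q ⟨k + 1, h⟩))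

/-- The value `Δ_TV (R'_{1:n})` returned by the algorithm. -/
def algorithmOutput {n q : ℕ} (hn : 0 < n) (P Q : Fin n → Fin q → ℝ) (ε : ℝ) : ℝ :=
  tvRatio (approxRatio P Q ε (n - 1) (Nat.sub_lt hn Nat.one_pos))

/-! ### The machine model: a real RAM

Programs work on natural-number index registers, real-number registers, and arrays of real
numbers that are addressed through index registers. Every elementary operation and every test
costs one step. The only real constants are natural numbers, and there is no conversion between
real numbers and indices: no rounding, and no exponential or logarithm. -/

/-- A state of the machine: index registers, real registers, and arrays of real cells. -/
structure State where
  idx : ℕ → ℕ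
  reg : ℕ → ℝ
  mem : ℕ → ℕ → ℝ

namespace State

def setIdx (s : State) (d v : ℕ) : State := { s with idx := Function.update s.idx d v }

def setReg (s : State) (d : ℕ) (v : ℝ) : State := { s with reg := Function.update s.reg d v }

def setMem (s : State) (a i : ℕ) (v : ℝ) : State :=
  { s with mem := Function.update s.mem a (Function.update (s.mem a) i v) }

end State

/-- Tests: comparisons of two index registers or of two real registers. -/
inductive Test : Type
  | idxLt (a b : ℕ)
  | idxLe (a b : ℕ)
  | regLt (a b : ℕ)
  | regLe (a b : ℕ)

/-- When a test succeeds. -/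
def Test.Holds (s : State) : Test → Prop
  | .idxLt a b => s.idx a < s.idx b
  | .idxLe a b => s.idx a ≤ s.idx b
  | .regLt a b => s.reg a < s.reg b
  | .regLe a b => s.reg a ≤ s.reg b

/-- Programs. The first argument `d` of an operation is the number of its target register. -/
inductive Program : Type
  | skip
  | idxConst (d v : ℕ)
  | idxAdd (d a b : ℕ)
  | idxSub (d a b : ℕ)
  | regConst (d v : ℕ)
  | regAdd (d a b : ℕ)
  | regSub (d a b : ℕ)
  | regMul (d a b : ℕ)
  | regDiv (d a b : ℕ)
  | load (d arr i : ℕ)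
  | store (arr i a : ℕ)
  | seq (c₁ c₂ : Program)
  | ite (b : Test) (c₁ c₂ : Program)
  | loop (b : Test) (c : Program)

/-- `Exec c s T s'`: started in state `s`, the program `c` halts after exactly `T` steps in state
`s'`. Subtraction of indices is truncated at `0`; a division by zero has no result, so a program
that attempts one does not halt properly. `loop b c` repeats `c` while `b` holds. -/
inductive Exec : Program → State → ℕ → State → Prop
  | skip (s : State) : Exec .skip s 1 s
  | idxConst (s : State) (d v : ℕ) : Exec (.idxConst d v) s 1 (s.setIdx d v)
  | idxAdd (s : State) (d a b : ℕ) : Exec (.idxAdd d a b) s 1 (s.setIdx d (s.idx a + s.idx b))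
  | idxSub (s : State) (d a b : ℕ) : Exec (.idxSub d a b) s 1 (s.setIdx d (s.idx a - s.idx b))
  | regConst (s : State) (d v : ℕ) : Exec (.regConst d v) s 1 (s.setReg d (v : ℝ))
  | regAdd (s : State) (d a b : ℕ) : Exec (.regAdd d a b) s 1 (s.setReg d (s.reg a + s.reg b))
  | regSub (s : State) (d a b : ℕ) : Exec (.regSub d a b) s 1 (s.setReg d (s.reg a - s.reg b))
  | regMul (s : State) (d a b : ℕ) : Exec (.regMul d a b) s 1 (s.setReg d (s.reg a * s.reg b))
  | regDiv (s : State) (d a b : ℕ) (hb : s.reg b ≠ 0) :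
      Exec (.regDiv d a b) s 1 (s.setReg d (s.reg a / s.reg b))
  | load (s : State) (d arr i : ℕ) : Exec (.load d arr i) s 1 (s.setReg d (s.mem arr (s.idx i)))
  | store (s : State) (arr i a : ℕ) :
      Exec (.store arr i a) s 1 (s.setMem arr (s.idx i) (s.reg a))
  | seq {c₁ c₂ : Program} {s s₁ s₂ : State} {T₁ T₂ : ℕ} :
      Exec c₁ s T₁ s₁ → Exec c₂ s₁ T₂ s₂ → Exec (.seq c₁ c₂) s (T₁ + T₂) s₂
  | iteTrue {b : Test} {c₁ c₂ : Program} {s s₁ : State} {T : ℕ} :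
      b.Holds s → Exec c₁ s T s₁ → Exec (.ite b c₁ c₂) s (T + 1) s₁
  | iteFalse {b : Test} {c₁ c₂ : Program} {s s₁ : State} {T : ℕ} :
      ¬ b.Holds s → Exec c₂ s T s₁ → Exec (.ite b c₁ c₂) s (T + 1) s₁
  | loopDone {b : Test} {c : Program} {s : State} :
      ¬ b.Holds s → Exec (.loop b c) s 1 s
  | loopStep {b : Test} {c : Program} {s s₁ s₂ : State} {T₁ T₂ : ℕ} :
      b.Holds s → Exec c s T₁ s₁ → Exec (.loop b c) s₁ T₂ s₂ →
        Exec (.loop b c) s (T₁ + T₂ + 1) s₂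

/-- The machine is deterministic: the running time and the final state of a halting computation
are determined by the program and the initial state. -/
theorem Exec.deterministic {c : Program} {s s₁ : State} {T₁ : ℕ} (h₁ : Exec c s T₁ s₁) :
    ∀ {T₂ : ℕ} {s₂ : State}, Exec c s T₂ s₂ → T₁ = T₂ ∧ s₁ = s₂ := by
  induction h₁ with
  | seq _ _ ih₁ ih₂ =>
    intro T₂ s₂ h
    cases h with
    | seq g₁ g₂ =>
      obtain ⟨rfl, rfl⟩ := ih₁ g₁
      obtain ⟨rfl, rfl⟩ := ih₂ g₂
      exact ⟨rfl, rfl⟩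
  | iteTrue hb _ ih =>
    intro T₂ s₂ h
    cases h with
    | iteTrue _ g =>
      obtain ⟨rfl, rfl⟩ := ih g
      exact ⟨rfl, rfl⟩
    | iteFalse hb2 _ => exact absurd hb hb2
  | iteFalse hb _ ih =>
    intro T₂ s₂ h
    cases h with
    | iteTrue hb2 _ => exact absurd hb2 hb
    | iteFalse _ g =>
      obtain ⟨rfl, rfl⟩ := ih g
      exact ⟨rfl, rfl⟩
  | loopDone hb =>
    intro T₂ s₂ h
    cases h with
    | loopDone _ => exact ⟨rfl, rfl⟩
    | loopStep hb2 _ _ => exact absurd hb2 hb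
  | loopStep hb _ _ ih₁ ih₂ =>
    intro T₂ s₂ h
    cases h with
    | loopDone hb2 => exact absurd hb hb2
    | loopStep _ g₁ g₂ =>
      obtain ⟨rfl, rfl⟩ := ih₁ g₁
      obtain ⟨rfl, rfl⟩ := ih₂ g₂
      exact ⟨rfl, rfl⟩
  | _ =>
    intro T₂ s₂ h
    cases h
    exact ⟨rfl, rfl⟩

/-- A table of `n` rows of `q` real numbers, laid out row by row (`M i j` in cell `i * q + j`)
and followed by zeros. -/
def rowMajor {n q : ℕ} (M : Fin n → Fin q → ℝ) (c : ℕ) : ℝ :=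
  if h : c < n * q then
    M (finProdFinEquiv.symm ⟨c, h⟩).1 (finProdFinEquiv.symm ⟨c, h⟩).2
  else 0

/-- The initial state: index registers `0` and `1` hold `n` and `q`, real register `0` holds `ε`,
arrays `0` and `1` hold the marginal distributions of `P` and `Q`, and all else is zero. -/
def inputState {n q : ℕ} (P Q : Fin n → Fin q → ℝ) (ε : ℝ) : State where
  idx := fun r => if r = 0 then n else if r = 1 then q else 0
  reg := fun r => if r = 0 then ε else 0
  mem := fun a => if a = 0 then rowMajor P else if a = 1 then rowMajor Q else fun _ => 0

/-- The output of a halted program: the content of real register `0`. -/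
def State.output (s : State) : ℝ := s.reg 0

end

end TVProduct

/-!
The total variation distance of two products is the expectation of `max (1 - X) 0` for the
product of the likelihood ratios of the coordinates. A ratio `R` is best seen as the family of the
vectors `(r * R r, R r)`, together with `(1 - E R, 0)` for the point `∞`; the vectors add up to
`(1, 1)`, and sparsification replaces the vectors in every bin by their sum.

*Error.* Let `Φ (y, p) = ∑ x, max (p * Q x - y * P x) 0` for the products `P`, `Q` of the rows that
are not yet processed. This function is homogeneous, subadditive, and one-sided Lipschitz in both
arguments (`IsTail`), and the distance encoded by a partially processed ratio is the sum of `Φ` over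
its vectors. Subadditivity shows that sparsification decreases this sum. Conversely, within a bin
the vectors have nearly the same slope; replacing each by its share of the sum moves it by at most
`ε * |y - p| + δ * (y + p)`, and half of this move is harmless because the moves cancel
(`cell_error`). Summed over all bins the loss is at most `ε * Δ + δ` (`expect_tail_le_sparsify`),
and the losses of all rounds add up to at most `ε * Δ` (`algorithmOutput_bounds`).

*Running time.* The combined vectors of the bins are sorted by slope (`bins_sorted`). Hence, after
multiplication by one entry of the next row, they can be distributed to the new bins in a single
merging pass, in time proportional to the number `2 * m + 3` of bins (`runs_merge`); no search is
needed. The number `m` and the breakpoints are found by repeated multiplication with `1 + ε`. As no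
bin contains points on both sides of `1`, sparsifying once more after the last round does not change
the output (`sum_bins_tv`), so that all rounds are alike. The program takes `O (n * q * (m + 1))`
steps (`runs_program`), and `m` is bounded in `numIntervals_add_one_le`.
-/

namespace TVProduct

noncomputable section

/-! ### The bins of the sparsification, in increasing order -/

/-- The breakpoint `a_t = 1 - (1 + ε)^(-t)` as a real number. -/
def cut (ε : ℝ) (t : ℕ) : ℝ := 1 - ((1 + ε) ^ t)⁻¹

/-- The ends of the `m + 1` cells of `[0, 1)`: cell `t` has the ends `cutTo ε m t` and
`cutTo ε m (t + 1)`. -/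
def cutTo (ε : ℝ) (m t : ℕ) : ℝ := if t ≤ m then cut ε t else 1

/-- The point `x` lies above bin number `c`, where the `2 * m + 3` bins
`I_0, …, I_m, {1}, J_m, …, J_0` are numbered from `0` in increasing order. The condition on the
bins from `{1}` on is multiplied out, so that it is never satisfied for the last bin. -/
def Beyond (ε : ℝ) (m c : ℕ) (x : ℝ) : Prop :=
  if c ≤ m then cutTo ε m (c + 1) ≤ x else 1 < cutTo ε m (2 * m + 2 - c) * x

/-- The number of the bin that contains `x`. -/
def bin (ε : ℝ) (m : ℕ) (x : ℝ) : ℕ := sInf {c | ¬ Beyond ε m c x}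

theorem cut_zero (ε : ℝ) : cut ε 0 = 0 := by simp [cut]

theorem cut_mono {ε : ℝ} (hε : 0 < ε) : Monotone (cut ε) := by
  intro s t hst
  unfold cut
  have : (1 + ε) ^ s ≤ (1 + ε) ^ t := pow_le_pow_right₀ (by linarith) hst
  gcongr

theorem cut_lt_one {ε : ℝ} (hε : 0 < ε) (t : ℕ) : cut ε t < 1 := by
  unfold cut
  have : 0 < ((1 + ε) ^ t)⁻¹ := by positivity
  linarith

theorem cut_succ_sub {ε : ℝ} (hε : 0 < ε) (t : ℕ) :
    cut ε (t + 1) - cut ε t = ε * (1 - cut ε (t + 1)) := by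
  unfold cut
  have : (0 : ℝ) < 1 + ε := by linarith
  field_simp
  ring

theorem cutTo_zero (ε : ℝ) (m : ℕ) : cutTo ε m 0 = 0 := by simp [cutTo, cut_zero]

theorem cutTo_mono {ε : ℝ} (hε : 0 < ε) (m : ℕ) : Monotone (cutTo ε m) := by
  intro s t hst
  unfold cutTo
  split_ifs with h1 h2
  · exact cut_mono hε hst
  · exact (cut_lt_one hε s).le
  · omega
  · exact le_rfl

theorem cutTo_nonneg {ε : ℝ} (hε : 0 < ε) (m t : ℕ) : 0 ≤ cutTo ε m t :=
  cutTo_zero ε m ▸ cutTo_mono hε m (Nat.zero_le t)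

theorem cutTo_le_one {ε : ℝ} (hε : 0 < ε) (m t : ℕ) : cutTo ε m t ≤ 1 := by
  unfold cutTo
  split_ifs
  · exact (cut_lt_one hε t).le
  · exact le_rfl

theorem not_beyond_last (ε : ℝ) (m : ℕ) (x : ℝ) : ¬ Beyond ε m (2 * m + 2) x := by
  have h : ¬ 2 * m + 2 ≤ m := by omega
  simp [Beyond, h, cutTo_zero]

theorem bin_le (ε : ℝ) (m : ℕ) (x : ℝ) : bin ε m x ≤ 2 * m + 2 :=
  Nat.sInf_le (not_beyond_last ε m x)

theorem not_beyond_bin (ε : ℝ) (m : ℕ) (x : ℝ) : ¬ Beyond ε m (bin ε m x) x :=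
  Nat.sInf_mem (s := {c | ¬ Beyond ε m c x}) ⟨_, not_beyond_last ε m x⟩

theorem beyond_of_lt_bin {ε : ℝ} {m c : ℕ} {x : ℝ} (h : c < bin ε m x) : Beyond ε m c x := by
  by_contra hc
  exact absurd (Nat.sInf_le (s := {c | ¬ Beyond ε m c x}) hc) (not_le.mpr h)

theorem Beyond.mono {ε : ℝ} (hε : 0 < ε) {m c : ℕ} {x y : ℝ} (hxy : x ≤ y)
    (h : Beyond ε m c x) : Beyond ε m c y := by
  unfold Beyond at *
  split_ifs at * with hc
  · exact h.trans hxy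
  · exact h.trans_le (mul_le_mul_of_nonneg_left hxy (cutTo_nonneg hε _ _))

theorem Beyond.of_succ {ε : ℝ} (hε : 0 < ε) {m c : ℕ} {x : ℝ} (hx : 0 ≤ x)
    (h : Beyond ε m (c + 1) x) : Beyond ε m c x := by
  unfold Beyond at *
  by_cases h1 : c + 1 ≤ m
  · rw [if_pos h1] at h
    rw [if_pos (by omega)]
    exact (cutTo_mono hε m (by omega)).trans h
  · rw [if_neg h1] at h
    have h2 : 1 < x := by
      have := mul_le_mul_of_nonneg_right (cutTo_le_one hε m (2 * m + 2 - (c + 1))) hx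
      linarith
    split_ifs with h3
    · exact (cutTo_le_one hε m _).trans h2.le
    · exact h.trans_le (mul_le_mul_of_nonneg_right (cutTo_mono hε m (by omega)) hx)

theorem Beyond.of_le {ε : ℝ} (hε : 0 < ε) {m c c' : ℕ} {x : ℝ} (hx : 0 ≤ x) (hc : c' ≤ c)
    (h : Beyond ε m c x) : Beyond ε m c' x := by
  induction hc with
  | refl => exact h
  | step _ ih => exact ih (h.of_succ hε hx)

theorem lt_bin_iff {ε : ℝ} (hε : 0 < ε) {m c : ℕ} {x : ℝ} (hx : 0 ≤ x) :
    c < bin ε m x ↔ Beyond ε m c x := by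
  refine ⟨beyond_of_lt_bin, fun h => ?_⟩
  by_contra hc
  exact not_beyond_bin ε m x (h.of_le hε hx (not_lt.mp hc))

theorem bin_mono {ε : ℝ} (hε : 0 < ε) (m : ℕ) {x y : ℝ} (hxy : x ≤ y) :
    bin ε m x ≤ bin ε m y := by
  by_contra h
  exact not_beyond_bin ε m y ((beyond_of_lt_bin (not_le.mp h)).mono hε hxy)

/-- The number of an interval in the increasing order of the bins. -/
def IntervalIndex.pos {m : ℕ} : IntervalIndex m → ℕ
  | .low t => t
  | .one => m + 1
  | .high t => 2 * m + 2 - t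

/-- The interval with a given number. -/
def IntervalIndex.ofPos (m c : ℕ) : IntervalIndex m :=
  if h : c ≤ m then .low ⟨c, by omega⟩
  else if c = m + 1 then .one
  else .high ⟨min m (2 * m + 2 - c), by omega⟩

theorem IntervalIndex.pos_ofPos {m c : ℕ} (hc : c < 2 * m + 3) : (ofPos m c).pos = c := by
  unfold ofPos
  split_ifs with h1 h2
  · rfl
  · simp [pos, h2]
  · simp only [pos]
    omega

theorem IntervalIndex.pos_injective {m : ℕ} : Function.Injective (pos (m := m)) := by
  rintro (s | _ | s) (t | _ | t) h <;> simp only [pos] at h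
  · congr 1; exact Fin.ext h
  · omega
  · omega
  · omega
  · rfl
  · omega
  · omega
  · omega
  · congr 1; apply Fin.ext; omega

theorem breakpoint_eq (ε : ℝ) (t : ℕ) : breakpoint ε t = ENNReal.ofReal (cut ε t) := rfl

theorem ofReal_le_inv_breakpoint {ε x : ℝ} (hx : 0 ≤ x) (t : ℕ) :
    ENNReal.ofReal x ≤ (breakpoint ε t)⁻¹ ↔ cut ε t * x ≤ 1 := by
  rw [ENNReal.le_inv_iff_mul_le, breakpoint_eq, ← ENNReal.ofReal_mul hx, ENNReal.ofReal_le_one,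
    mul_comm]

/-- A nonnegative number belongs to the interval with the number of its bin, and to no other. -/
theorem mem_intervals_iff {ε : ℝ} (hε : 0 < ε) {m : ℕ} {x : ℝ} (hx : 0 ≤ x)
    (b : IntervalIndex m) : ENNReal.ofReal x ∈ intervals ε m b ↔ bin ε m x = b.pos := by
  have key : ∀ c, bin ε m x = c ↔ (c = 0 ∨ Beyond ε m (c - 1) x) ∧ ¬ Beyond ε m c x := by
    intro c
    rw [← lt_bin_iff hε hx, ← lt_bin_iff hε hx]
    omega
  have hlow : ∀ t : ℕ, breakpoint ε t ≤ ENNReal.ofReal x ↔ cut ε t ≤ x := fun t => by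
    rw [breakpoint_eq, ENNReal.ofReal_le_ofReal_iff hx]
  have hinv : ∀ t : ℕ, (breakpoint ε t)⁻¹ < ENNReal.ofReal x ↔ 1 < cut ε t * x := fun t => by
    rw [← not_le, ofReal_le_inv_breakpoint hx, not_le]
  have h1 : ENNReal.ofReal x < 1 ↔ x < 1 := by
    rw [← ENNReal.ofReal_one, ENNReal.ofReal_lt_ofReal_iff one_pos]
  have h1' : 1 < ENNReal.ofReal x ↔ 1 < x := by
    rw [← not_le, ENNReal.ofReal_le_one, not_le]
  rw [key]
  rcases b with t | _ | t
  · have ht : (t : ℕ) ≤ m := by omega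
    have hl : ((t : ℕ) = 0 ∨ Beyond ε m (t - 1) x) ↔ cut ε t ≤ x := by
      rcases Nat.eq_zero_or_pos (t : ℕ) with h0 | h0
      · simp [h0, cut_zero, hx]
      · have e : (t : ℕ) - 1 + 1 = t := by omega
        have : ¬ (t : ℕ) = 0 := by omega
        have h3 : (t : ℕ) - 1 ≤ m := by omega
        simp [Beyond, e, this, h3, cutTo, ht]
    simp only [intervals, IntervalIndex.pos, hl]
    split_ifs with h
    · have : (t : ℕ) + 1 ≤ m := h
      rw [Set.mem_Ico, hlow, ← not_le, hlow]
      simp [Beyond, ht, cutTo, this]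
    · have e : (t : ℕ) = m := by omega
      rw [Set.mem_Ico, hlow, h1]
      simp [Beyond, cutTo, e]
  · have e : 2 * m + 2 - (m + 1) = m + 1 := by omega
    have : ENNReal.ofReal x = 1 ↔ x = 1 := ENNReal.ofReal_eq_one
    simp only [intervals, IntervalIndex.pos, Set.mem_singleton_iff, this]
    have e0 : ¬ m + 1 ≤ m := by omega
    have e1 : ¬ m + 1 = 0 := by omega
    simp only [Beyond, cutTo, e, e0, e1, Nat.add_sub_cancel, le_refl, if_true, if_false,
      false_or, one_mul, not_lt]
    rw [le_antisymm_iff, and_comm]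
  · have ht : (t : ℕ) ≤ m := by omega
    have hu : ¬ Beyond ε m (2 * m + 2 - t) x ↔ cut ε t * x ≤ 1 := by
      have a1 : ¬ 2 * m + 2 - (t : ℕ) ≤ m := by omega
      have a2 : 2 * m + 2 - (2 * m + 2 - (t : ℕ)) = t := by omega
      simp [Beyond, a1, a2, cutTo, ht]
    have h0 : ¬ 2 * m + 2 - (t : ℕ) = 0 := by omega
    simp only [intervals, IntervalIndex.pos, hu, h0, false_or]
    have a1 : ¬ 2 * m + 2 - (t : ℕ) - 1 ≤ m := by omega
    have a2 : 2 * m + 2 - (2 * m + 2 - (t : ℕ) - 1) = t + 1 := by omega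
    split_ifs with h
    · have h5 : (t : ℕ) + 1 ≤ m := h
      rw [Set.mem_Ioc, hinv, ofReal_le_inv_breakpoint hx]
      simp [Beyond, a1, a2, cutTo, h5]
    · have e : (t : ℕ) = m := by omega
      rw [Set.mem_Ioc, h1', e, ofReal_le_inv_breakpoint hx]
      rw [e] at a1 a2
      simp [Beyond, a1, a2, cutTo]

theorem top_mem_intervals_iff {ε : ℝ} (hε : 0 < ε) {m : ℕ} (b : IntervalIndex m) :
    ⊤ ∈ intervals ε m b ↔ 2 * m + 2 = b.pos := by
  have hb : ∀ t, breakpoint ε t = 0 ↔ t = 0 := by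
    intro t
    rw [breakpoint_eq, ENNReal.ofReal_eq_zero]
    constructor
    · intro h
      by_contra h0
      have h2 := cut_mono hε (Nat.one_le_iff_ne_zero.mpr h0)
      have h3 := cut_succ_sub hε 0
      have h4 := mul_pos hε (sub_pos.mpr (cut_lt_one hε 1))
      rw [cut_zero, zero_add] at h3
      linarith
    · rintro rfl
      exact (cut_zero ε).le
  rcases b with t | _ | t
  · have : ¬ 2 * m + 2 = (t : ℕ) := by omega
    simp only [intervals, IntervalIndex.pos, this, iff_false]
    split_ifs <;> simp
  · have : ¬ 2 * m + 2 = m + 1 := by omega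
    simp [intervals, IntervalIndex.pos, this]
  · have h0 : 2 * m + 2 = 2 * m + 2 - (t : ℕ) ↔ (t : ℕ) = 0 := by omega
    simp only [intervals, IntervalIndex.pos, h0]
    split_ifs with h
    · simp [hb, lt_top_iff_ne_top]
    · have e : (t : ℕ) = m := by omega
      simp [hb, e]

theorem collapse_eq {ι : Type*} {I : ι → Set ℝ≥0∞} {r : ℝ≥0∞} {b : ι}
    (h : ∀ b', r ∈ I b' ↔ b' = b) : collapse I r = Sum.inl b := by
  have hex : ∃ t, r ∈ I t := ⟨b, (h b).mpr rfl⟩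
  rw [collapse, dif_pos hex, (h _).mp hex.choose_spec]

theorem collapse_ofReal {ε : ℝ} (hε : 0 < ε) {m : ℕ} {x : ℝ} (hx : 0 ≤ x) :
    collapse (intervals ε m) (ENNReal.ofReal x) = Sum.inl (.ofPos m (bin ε m x)) := by
  refine collapse_eq fun b' => ?_
  have h := IntervalIndex.pos_ofPos (Nat.lt_succ_of_le (bin_le ε m x))
  rw [mem_intervals_iff hε hx, ← IntervalIndex.pos_injective.eq_iff, h, eq_comm]

theorem collapse_top {ε : ℝ} (hε : 0 < ε) {m : ℕ} :
    collapse (intervals ε m) ⊤ = Sum.inl (.ofPos m (2 * m + 2)) := by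
  refine collapse_eq fun b' => ?_
  have h := IntervalIndex.pos_ofPos (Nat.lt_succ_self (2 * m + 2))
  rw [top_mem_intervals_iff hε, ← IntervalIndex.pos_injective.eq_iff, h, eq_comm]

/-! ### Sparsification as a sum over the bins -/

/-- The expectation of `f X` for `X` with law `R`, as a linear functional of `R`. -/
def expect (f : ℝ → ℝ) : (ℝ →₀ ℝ) →ₗ[ℝ] ℝ := Finsupp.linearCombination ℝ f

theorem expect_eq_sum (f : ℝ → ℝ) (R : ℝ →₀ ℝ) :
    expect f R = ∑ r ∈ R.support, R r * f r := by
  simp [expect, Finsupp.linearCombination_apply, Finsupp.sum]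

/-- The mass that `R` gives to bin `c`. -/
def binMass (ε : ℝ) (m : ℕ) (R : ℝ →₀ ℝ) (c : ℕ) : ℝ :=
  expect (fun r => if bin ε m r = c then 1 else 0) R

/-- The mass that `R†` gives to bin `c`; the last bin contains `∞`. -/
def binMoment (ε : ℝ) (m : ℕ) (R : ℝ →₀ ℝ) (c : ℕ) : ℝ :=
  expect (fun r => if bin ε m r = c then r else 0) R +
    if c = 2 * m + 2 then 1 - expect (fun r => r) R else 0

/-- The ratio with mass `p c` at `Y c / p c` for every bin `c`. -/
def binRatio (m : ℕ) (Y p : ℕ → ℝ) : ℝ →₀ ℝ :=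
  ∑ c ∈ Finset.range (2 * m + 3), Finsupp.single (Y c / p c) (p c)

theorem sparsify_eq {ε : ℝ} (hε : 0 < ε) (δ : ℝ) {R : ℝ →₀ ℝ} (hR : ∀ r ∈ R.support, 0 ≤ r) :
    sparsify R ε δ = binRatio (numIntervals ε δ) (binMoment ε (numIntervals ε δ) R)
      (binMass ε (numIntervals ε δ) R) := by
  classical
  set m := numIntervals ε δ with hm
  set κ := collapse (intervals ε m) with hκ
  have hE : (extend R).mapDomain κ =
      ∑ r ∈ R.support, Finsupp.single (Sum.inl (.ofPos m (bin ε m r))) (R r) := by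
    rw [extend, ← Finsupp.mapDomain_comp, Finsupp.mapDomain, Finsupp.sum]
    exact Finset.sum_congr rfl fun r hr => by
      rw [Function.comp_apply, hκ, collapse_ofReal hε (hR r hr)]
  have hD : (dagger R).mapDomain κ =
      (∑ r ∈ R.support, Finsupp.single (Sum.inl (.ofPos m (bin ε m r))) (r * R r)) +
        Finsupp.single (Sum.inl (.ofPos m (2 * m + 2))) (1 - expect (fun r => r) R) := by
    rw [dagger, Finsupp.mapDomain_add, Finsupp.mapDomain_single, hκ, collapse_top hε, Finsupp.sum,
      Finsupp.mapDomain_finsetSum]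
    congr 1
    · exact Finset.sum_congr rfl fun r hr => by
        rw [Finsupp.mapDomain_single, collapse_ofReal hε (hR r hr)]
    · rw [expect_eq_sum, Finsupp.sum]
      simp only [mul_comm]
  have hinj : Set.InjOn (fun c => (Sum.inl (IntervalIndex.ofPos m c) : IntervalIndex m ⊕ ℝ≥0∞))
      (Finset.range (2 * m + 3)) := by
    intro c hc c' hc' h
    have hc := Finset.mem_range.mp hc
    have hc' := Finset.mem_range.mp hc'
    have := congrArg IntervalIndex.pos (Sum.inl_injective h)
    rwa [IntervalIndex.pos_ofPos hc, IntervalIndex.pos_ofPos hc'] at this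
  have heq : ∀ {c}, c < 2 * m + 3 → ∀ {r}, r < 2 * m + 3 →
      ((Sum.inl (.ofPos m r) : IntervalIndex m ⊕ ℝ≥0∞) = Sum.inl (.ofPos m c) ↔ r = c) :=
    fun hc _ hr => hinj.eq_iff (Finset.mem_coe.mpr (Finset.mem_range.mpr hr))
      (Finset.mem_coe.mpr (Finset.mem_range.mpr hc))
  have hbl : ∀ r, bin ε m r < 2 * m + 3 := fun r => Nat.lt_succ_of_le (bin_le ε m r)
  have hEc : ∀ c < 2 * m + 3,
      (extend R).mapDomain κ (Sum.inl (.ofPos m c)) = binMass ε m R c := by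
    intro c hc
    rw [hE, Finsupp.finsetSum_apply, binMass, expect_eq_sum]
    refine Finset.sum_congr rfl fun r _ => ?_
    simp [Finsupp.single_apply, heq hc (hbl r)]
  have hDc : ∀ c < 2 * m + 3,
      (dagger R).mapDomain κ (Sum.inl (.ofPos m c)) = binMoment ε m R c := by
    intro c hc
    rw [hD, Finsupp.add_apply, Finsupp.finsetSum_apply, binMoment,
      expect_eq_sum (fun r => if bin ε m r = c then r else 0)]
    congr 1
    · refine Finset.sum_congr rfl fun r _ => ?_
      simp only [Finsupp.single_apply, heq hc (hbl r)]
      split_ifs <;> simp [mul_comm]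
    · rw [Finsupp.single_apply]
      simp [heq hc (Nat.lt_succ_self (2 * m + 2)), eq_comm]
  have hsupp : ((extend R).mapDomain κ).support ⊆
      (Finset.range (2 * m + 3)).image (fun c => Sum.inl (IntervalIndex.ofPos m c)) := by
    rw [hE]
    refine Finsupp.support_finsetSum.trans ?_
    intro x hx
    obtain ⟨r, _, hx⟩ := Finset.mem_biUnion.mp hx
    have := Finset.mem_singleton.mp (Finsupp.support_single_subset hx)
    exact Finset.mem_image.mpr ⟨_, Finset.mem_range.mpr (hbl r), this.symm⟩
  rw [sparsify, ← hm, sparsifyWrtIntervals, ← hκ, ratio]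
  refine (Finsupp.sum_of_support_subset _ hsupp _ fun _ _ => Finsupp.single_zero _).trans ?_
  rw [Finset.sum_image hinj, binRatio]
  refine Finset.sum_congr rfl fun c hc => ?_
  have hc := Finset.mem_range.mp hc
  rw [hEc c hc, hDc c hc]

/-! ### Ratios as positive functionals -/

@[simp] theorem expect_single (f : ℝ → ℝ) (r p : ℝ) : expect f (Finsupp.single r p) = p * f r := by
  simp [expect]

theorem expect_apply (f : ℝ → ℝ) (R : ℝ →₀ ℝ) : expect f R = R.sum fun r p => p * f r := rfl

theorem expect_mul_const (f : ℝ → ℝ) (a : ℝ) (R : ℝ →₀ ℝ) :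
    expect (fun r => f r * a) R = expect f R * a := by
  simp only [expect_eq_sum, Finset.sum_mul, mul_assoc]

theorem tvRatio_eq_expect (R : ℝ →₀ ℝ) : tvRatio R = expect (fun r => max (1 - r) 0) R := by
  rw [expect_apply, tvRatio]
  simp only [mul_comm]

theorem expect_mulIndep (f : ℝ → ℝ) (R S : ℝ →₀ ℝ) :
    expect f (mulIndep R S) = expect (fun r => expect (fun s => f (r * s)) S) R := by
  rw [mulIndep, Finsupp.sum, map_sum, expect_eq_sum _ R]
  refine Finset.sum_congr rfl fun r _ => ?_
  rw [Finsupp.sum, map_sum, expect_eq_sum _ S, Finset.mul_sum]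
  exact Finset.sum_congr rfl fun s _ => by rw [expect_single]; ring

theorem expect_ratioFin {q : ℕ} (f : ℝ → ℝ) (P Q : Fin q → ℝ) :
    expect f (ratioFin P Q) = ∑ j, Q j * f (P j / Q j) := by
  rw [ratioFin, ratio, Finsupp.sum_fintype _ _ (fun _ => Finsupp.single_zero _), map_sum]
  exact Finset.sum_congr rfl fun j _ => by simp

theorem expect_binRatio (f : ℝ → ℝ) (m : ℕ) (Y p : ℕ → ℝ) :
    expect f (binRatio m Y p) = ∑ c ∈ Finset.range (2 * m + 3), p c * f (Y c / p c) := by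
  rw [binRatio, map_sum]
  exact Finset.sum_congr rfl fun c _ => expect_single _ _ _

/-- A ratio: a distribution on `[0, ∞)` with mean at most `1`. Positivity of the mass function and
of its support are stated together, as positivity of the expectation functional. -/
structure IsRatio (R : ℝ →₀ ℝ) : Prop where
  nonneg : ∀ f : ℝ → ℝ, (∀ r, 0 ≤ r → 0 ≤ f r) → 0 ≤ expect f R
  mass : expect (fun _ => 1) R = 1
  mean : expect (fun r => r) R ≤ 1

theorem expect_indicator (R : ℝ →₀ ℝ) (a : ℝ) (r₀ : ℝ) :
    expect (fun r => if r = r₀ then a else 0) R = R r₀ * a := by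
  classical
  rw [expect_eq_sum]
  simp only [mul_ite, mul_zero]
  rw [Finset.sum_ite_eq']
  split_ifs with h
  · rfl
  · rw [Finsupp.notMem_support_iff.mp h, zero_mul]

namespace IsRatio

variable {R S : ℝ →₀ ℝ}

theorem apply_nonneg (hR : IsRatio R) (r : ℝ) : 0 ≤ R r := by
  have := hR.nonneg (fun x => if x = r then 1 else 0) (fun x _ => by positivity)
  rwa [expect_indicator, mul_one] at this

theorem support_nonneg (hR : IsRatio R) : ∀ r ∈ R.support, 0 ≤ r := by
  intro r hr
  by_contra h
  have h1 := hR.nonneg (fun x => if x = r then -1 else 0) (fun x hx => by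
    rw [if_neg]
    rintro rfl
    exact h hx)
  rw [expect_indicator] at h1
  have h2 := hR.apply_nonneg r
  exact (Finsupp.mem_support_iff.mp hr) (by linarith)

protected theorem mulIndep (hR : IsRatio R) (hS : IsRatio S) : IsRatio (mulIndep R S) where
  nonneg f hf := by
    rw [expect_mulIndep]
    exact hR.nonneg _ fun r hr => hS.nonneg _ fun s hs => hf _ (mul_nonneg hr hs)
  mass := by
    rw [expect_mulIndep]
    simp only [hS.mass, hR.mass]
  mean := by
    rw [expect_mulIndep]
    have : ∀ r, expect (fun s => r * s) S = r * expect (fun s => s) S := fun r => by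
      simp only [mul_comm r, expect_mul_const]
    simp only [this, expect_mul_const]
    exact mul_le_one₀ hR.mean (hS.nonneg _ fun _ h => h) hS.mean

protected theorem ratioFin {q : ℕ} {P Q : Fin q → ℝ} (hP : P ∈ stdSimplex ℝ (Fin q))
    (hQ : Q ∈ stdSimplex ℝ (Fin q)) : IsRatio (ratioFin P Q) where
  nonneg f hf := by
    rw [expect_ratioFin]
    exact Finset.sum_nonneg fun j _ =>
      mul_nonneg (hQ.1 j) (hf _ (div_nonneg (hP.1 j) (hQ.1 j)))
  mass := by
    rw [expect_ratioFin]
    simpa using hQ.2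
  mean := by
    rw [expect_ratioFin, ← hP.2]
    refine Finset.sum_le_sum fun j _ => ?_
    rcases eq_or_ne (Q j) 0 with h | h
    · simpa [h] using hP.1 j
    · rw [mul_div_cancel₀ _ h]

end IsRatio

/-! ### A ratio as a family of vectors

A ratio `R` is the family of the vectors `(r * R r, R r)`, completed by the vector
`(1 - E R, 0)` that stands for the point `∞` of the alternative ratio. The sum of the family is
`(1, 1)`, and sparsification adds up the vectors in every bin. -/

/-- The finite points and the point `∞`. -/
def points (R : ℝ →₀ ℝ) : Finset (Option ℝ) := Finset.insertNone R.support

/-- The mass of the alternative ratio at a point. -/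
def ptMoment (R : ℝ →₀ ℝ) : Option ℝ → ℝ
  | none => 1 - expect (fun r => r) R
  | some r => R r * r

/-- The mass of the ratio at a point. -/
def ptMass (R : ℝ →₀ ℝ) : Option ℝ → ℝ
  | none => 0
  | some r => R r

/-- The bin of a point. -/
def ptBin (ε : ℝ) (m : ℕ) : Option ℝ → ℕ
  | none => 2 * m + 2
  | some r => bin ε m r

theorem ptBin_lt (ε : ℝ) (m : ℕ) (i : Option ℝ) : ptBin ε m i < 2 * m + 3 := by
  rcases i with _ | r
  · exact Nat.lt_succ_self _
  · exact Nat.lt_succ_of_le (bin_le ε m r)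

theorem binMoment_eq_sum (ε : ℝ) (m : ℕ) (R : ℝ →₀ ℝ) (c : ℕ) :
    binMoment ε m R c = ∑ i ∈ points R with ptBin ε m i = c, ptMoment R i := by
  rw [binMoment, expect_eq_sum (fun r => if bin ε m r = c then r else 0), Finset.sum_filter,
    points, Finset.sum_insertNone, add_comm]
  simp [ptBin, ptMoment, eq_comm]

theorem binMass_eq_sum (ε : ℝ) (m : ℕ) (R : ℝ →₀ ℝ) (c : ℕ) :
    binMass ε m R c = ∑ i ∈ points R with ptBin ε m i = c, ptMass R i := by
  have h0 : (if ptBin ε m none = c then ptMass R none else 0) = 0 := ite_self _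
  rw [binMass, expect_eq_sum, Finset.sum_filter, points, Finset.sum_insertNone, h0, zero_add]
  simp only [ptBin, ptMass, mul_ite, mul_one, mul_zero]
  rfl

theorem sum_bins {ε : ℝ} {m : ℕ} (R : ℝ →₀ ℝ) (f : Option ℝ → ℝ) :
    ∑ c ∈ Finset.range (2 * m + 3), ∑ i ∈ points R with ptBin ε m i = c, f i =
      ∑ i ∈ points R, f i :=
  Finset.sum_fiberwise_of_maps_to (fun i _ => Finset.mem_range.mpr (ptBin_lt ε m i)) f

theorem sum_ptMoment (R : ℝ →₀ ℝ) : ∑ i ∈ points R, ptMoment R i = 1 := by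
  rw [points, Finset.sum_insertNone, ptMoment, expect_eq_sum]
  simp only [ptMoment]
  ring

theorem sum_ptMass {R : ℝ →₀ ℝ} (hR : IsRatio R) : ∑ i ∈ points R, ptMass R i = 1 := by
  rw [points, Finset.sum_insertNone, ← hR.mass, expect_eq_sum]
  simp [ptMass]

theorem ptMass_nonneg {R : ℝ →₀ ℝ} (hR : IsRatio R) (i : Option ℝ) : 0 ≤ ptMass R i := by
  rcases i with _ | r
  · exact le_rfl
  · exact hR.apply_nonneg r

theorem ptMoment_nonneg {R : ℝ →₀ ℝ} (hR : IsRatio R) {i : Option ℝ} (hi : i ∈ points R) :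
    0 ≤ ptMoment R i := by
  rcases i with _ | r
  · exact sub_nonneg.mpr hR.mean
  · exact mul_nonneg (hR.apply_nonneg r) (hR.support_nonneg r (by simpa [points] using hi))

theorem bin_spec (ε : ℝ) (m : ℕ) {x : ℝ} (hx : 0 ≤ x) :
    (bin ε m x ≤ m ∧ cutTo ε m (bin ε m x) ≤ x ∧ x ≤ cutTo ε m (bin ε m x + 1)) ∨
    (bin ε m x = m + 1 ∧ x = 1) ∨
    ∃ t ≤ m, bin ε m x = 2 * m + 2 - t ∧ cutTo ε m t * x ≤ 1 ∧ 1 ≤ cutTo ε m (t + 1) * x := by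
  have hu := not_beyond_bin ε m x
  have hl : ∀ c, bin ε m x = c + 1 → Beyond ε m c x := fun c hc => beyond_of_lt_bin (by omega)
  have hb := bin_le ε m x
  obtain ⟨c, hc⟩ : ∃ c, bin ε m x = c := ⟨_, rfl⟩
  rw [hc] at hu hl hb ⊢
  rcases lt_trichotomy c (m + 1) with h | h | h
  · left
    have h' : c ≤ m := by omega
    refine ⟨h', ?_, ?_⟩
    · rcases c with _ | c
      · rwa [cutTo_zero]
      · have := hl c rfl
        rwa [Beyond, if_pos (by omega)] at this
    · rw [Beyond, if_pos h', not_le] at hu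
      exact hu.le
  · right; left
    refine ⟨h, ?_⟩
    have h1 := hl m h
    subst h
    have e : 2 * m + 2 - (m + 1) = m + 1 := by omega
    rw [Beyond, if_neg (by omega), e] at hu
    rw [Beyond, if_pos le_rfl] at h1
    simp only [cutTo, Nat.not_succ_le_self, if_false, one_mul, not_lt] at hu h1
    exact le_antisymm hu h1
  · right; right
    refine ⟨2 * m + 2 - c, by omega, by omega, ?_, ?_⟩
    · rw [Beyond, if_neg (by omega), not_lt] at hu
      exact hu
    · have h1 := hl (c - 1) (by omega)
      rw [Beyond, if_neg (by omega)] at h1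
      have e : 2 * m + 2 - (c - 1) = 2 * m + 2 - c + 1 := by omega
      rw [e] at h1
      exact h1.le

/-- Where the vector of a point lies relative to its bin. -/
theorem ptBin_spec {ε : ℝ} (hε : 0 < ε) (m : ℕ) {R : ℝ →₀ ℝ} (hR : IsRatio R) {i : Option ℝ}
    (hi : i ∈ points R) :
    (ptBin ε m i ≤ m ∧ cutTo ε m (ptBin ε m i) * ptMass R i ≤ ptMoment R i ∧
      ptMoment R i ≤ cutTo ε m (ptBin ε m i + 1) * ptMass R i) ∨
    (ptBin ε m i = m + 1 ∧ ptMoment R i = ptMass R i) ∨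
    ∃ t ≤ m, ptBin ε m i = 2 * m + 2 - t ∧ cutTo ε m t * ptMoment R i ≤ ptMass R i ∧
      ptMass R i ≤ cutTo ε m (t + 1) * ptMoment R i := by
  have h0 := ptMoment_nonneg hR hi
  rcases i with _ | r
  · right; right
    refine ⟨0, Nat.zero_le _, rfl, ?_, ?_⟩
    · rw [cutTo_zero, zero_mul]; exact le_rfl
    · exact mul_nonneg (cutTo_nonneg hε _ _) h0
  · have hr := hR.support_nonneg r (by simpa [points] using hi)
    have hp := hR.apply_nonneg r
    simp only [ptBin, ptMass, ptMoment]
    rcases bin_spec ε m hr with ⟨h1, h2, h3⟩ | ⟨h1, h2⟩ | ⟨t, ht, h1, h2, h3⟩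
    · exact .inl ⟨h1, by nlinarith, by nlinarith⟩
    · exact .inr (.inl ⟨h1, by rw [h2, mul_one]⟩)
    · exact .inr (.inr ⟨t, ht, h1, by nlinarith, by nlinarith⟩)

/-! ### Total variation distance of a rescaled pair of products -/

/-- The properties of the function `(y, p) ↦ ∑ x, max (p * Q x - y * P x) 0` for a pair `P`, `Q`
of distributions that the error analysis rests on. -/
structure IsTail (Φ : ℝ → ℝ → ℝ) : Prop where
  smul : ∀ a y p, 0 ≤ a → Φ (a * y) (a * p) = a * Φ y p
  add_le : ∀ y p y' p', Φ (y + y') (p + p') ≤ Φ y p + Φ y' p'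
  left : ∀ y y' p, Φ y p ≤ Φ y' p + max (y' - y) 0
  right : ∀ y p p', Φ y p ≤ Φ y p' + max (p - p') 0
  zero_right : ∀ y, 0 ≤ y → Φ y 0 = 0
  lower : ∀ y p, max (p - y) 0 ≤ Φ y p

theorem IsTail.zero {Φ : ℝ → ℝ → ℝ} (h : IsTail Φ) : Φ 0 0 = 0 := h.zero_right 0 le_rfl

theorem IsTail.nonneg {Φ : ℝ → ℝ → ℝ} (h : IsTail Φ) (y p : ℝ) : 0 ≤ Φ y p :=
  (le_max_right _ _).trans (h.lower y p)

theorem IsTail.sum_le {Φ : ℝ → ℝ → ℝ} (h : IsTail Φ) {ι : Type*} (s : Finset ι) (y p : ι → ℝ) :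
    Φ (∑ i ∈ s, y i) (∑ i ∈ s, p i) ≤ ∑ i ∈ s, Φ (y i) (p i) := by
  classical
  induction s using Finset.induction_on with
  | empty => simp [h.zero]
  | insert a s ha ih =>
    simp only [Finset.sum_insert ha]
    exact (h.add_le _ _ _ _).trans (by gcongr)

theorem isTail_base : IsTail fun y p => max (p - y) 0 where
  smul a y p ha := by
    rw [← mul_sub, mul_max_of_nonneg _ _ ha, mul_zero]
  add_le y p y' p' := by
    refine max_le ?_ (by positivity)
    have h1 := le_max_left (p - y) 0
    have h2 := le_max_left (p' - y') 0
    linarith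
  left y y' p := by
    refine max_le ?_ (by positivity)
    have h1 := le_max_left (p - y') 0
    have h2 := le_max_left (y' - y) 0
    linarith
  right y p p' := by
    refine max_le ?_ (by positivity)
    have h1 := le_max_left (p' - y) 0
    have h2 := le_max_left (p - p') 0
    linarith
  zero_right y hy := by simpa using hy
  lower y p := le_rfl

/-- One more coordinate. -/
theorem IsTail.step {Φ : ℝ → ℝ → ℝ} (h : IsTail Φ) {q : ℕ} {P Q : Fin q → ℝ}
    (hP : P ∈ stdSimplex ℝ (Fin q)) (hQ : Q ∈ stdSimplex ℝ (Fin q)) :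
    IsTail fun y p => ∑ j, Φ (y * P j) (p * Q j) where
  smul a y p ha := by
    simp only [mul_assoc, h.smul _ _ _ ha, Finset.mul_sum]
  add_le y p y' p' := by
    simp only [add_mul, ← Finset.sum_add_distrib]
    exact Finset.sum_le_sum fun j _ => h.add_le _ _ _ _
  left y y' p := by
    have e : max (y' - y) 0 = ∑ j, max (y' * P j - y * P j) 0 := by
      rw [← mul_one (max (y' - y) 0), ← hP.2, Finset.mul_sum]
      refine Finset.sum_congr rfl fun j _ => ?_
      rw [max_mul_of_nonneg _ _ (hP.1 j), zero_mul, sub_mul]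
    rw [e, ← Finset.sum_add_distrib]
    exact Finset.sum_le_sum fun j _ => h.left _ _ _
  right y p p' := by
    have e : max (p - p') 0 = ∑ j, max (p * Q j - p' * Q j) 0 := by
      rw [← mul_one (max (p - p') 0), ← hQ.2, Finset.mul_sum]
      refine Finset.sum_congr rfl fun j _ => ?_
      rw [max_mul_of_nonneg _ _ (hQ.1 j), zero_mul, sub_mul]
    rw [e, ← Finset.sum_add_distrib]
    exact Finset.sum_le_sum fun j _ => h.right _ _ _
  zero_right y hy := by
    simp only [zero_mul]
    exact Finset.sum_eq_zero fun j _ => h.zero_right _ (mul_nonneg hy (hP.1 j))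
  lower y p := by
    have := h.sum_le Finset.univ (fun j => y * P j) (fun j => p * Q j)
    rw [← Finset.mul_sum, ← Finset.mul_sum, hP.2, hQ.2, mul_one, mul_one] at this
    exact (h.lower y p).trans this

/-- The error made by adding up the vectors `(a i, b i)` in one cell: if the slopes `a i / b i`
lie in `[lo, hi]`, every vector moves by at most `b i * (hi - lo)`, and since the signed moves
cancel, only half of the total move counts against a function that is one-sided Lipschitz. -/
theorem cell_error {ι : Type*} {s : Finset ι} {a b : ι → ℝ} {lo hi ε δ σ : ℝ}
    {Ψ : ℝ → ℝ → ℝ} (hb : ∀ i ∈ s, 0 ≤ b i) (hlo : ∀ i ∈ s, lo * b i ≤ a i)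
    (hhi : ∀ i ∈ s, a i ≤ hi * b i) (hε : 0 ≤ ε) (hw : hi - lo ≤ ε * (1 - hi) + δ)
    (hsmul : ∀ c x y, 0 ≤ c → Ψ (c * x) (c * y) = c * Ψ x y)
    (hlip : ∀ x x' y, Ψ x y ≤ Ψ x' y + (|x' - x| + σ * (x' - x)) / 2) :
    ∑ i ∈ s, Ψ (a i) (b i) ≤ Ψ (∑ i ∈ s, a i) (∑ i ∈ s, b i) +
      ∑ i ∈ s, (ε * (b i - a i) + δ * b i) / 2 := by
  set A := ∑ i ∈ s, a i with hA
  set B := ∑ i ∈ s, b i with hB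
  have hAlo : lo * B ≤ A := by
    rw [hA, hB, Finset.mul_sum]; exact Finset.sum_le_sum hlo
  have hAhi : A ≤ hi * B := by
    rw [hA, hB, Finset.mul_sum]; exact Finset.sum_le_sum hhi
  rcases (Finset.sum_nonneg hb).eq_or_lt with h0 | h0
  · have hb0 : ∀ i ∈ s, b i = 0 := (Finset.sum_eq_zero_iff_of_nonneg hb).mp h0.symm
    have ha0 : ∀ i ∈ s, a i = 0 := fun i hi => by
      have h1 := hlo i hi
      have h2 := hhi i hi
      rw [hb0 i hi, mul_zero] at h1 h2
      exact le_antisymm h2 h1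
    have hz : Ψ 0 0 = 0 := by simpa using hsmul 0 0 0 le_rfl
    have e1 : A = 0 := Finset.sum_eq_zero ha0
    have e2 : B = 0 := h0.symm
    rw [e1, e2, hz, Finset.sum_eq_zero, Finset.sum_eq_zero]
    · simp
    · intro i hi; simp [ha0 i hi, hb0 i hi]
    · intro i hi; simp [ha0 i hi, hb0 i hi, hz]
  · have hB0 : 0 < B := h0
    set μ := A / B with hμ
    have hμB : B * μ = A := by rw [hμ]; field_simp
    have h1 : lo ≤ μ := by rw [hμ, le_div_iff₀ hB0]; exact hAlo
    have h2 : μ ≤ hi := by rw [hμ, div_le_iff₀ hB0]; exact hAhi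
    have hsum : Ψ A B = ∑ i ∈ s, b i * Ψ μ 1 := by
      rw [← Finset.sum_mul, ← hB, ← hsmul _ _ _ hB0.le, hμB, mul_one]
    have hzero : ∑ i ∈ s, σ * (b i * μ - a i) / 2 = 0 := by
      rw [← Finset.sum_div, ← Finset.mul_sum, Finset.sum_sub_distrib, ← Finset.sum_mul, ← hB,
        ← hA, hμB]
      simp
    rw [hsum, ← add_zero (_ + _), ← hzero, ← Finset.sum_add_distrib, ← Finset.sum_add_distrib]
    refine Finset.sum_le_sum fun i hi => ?_
    have hbi := hb i hi
    have h3 := hlip (a i) (b i * μ) (b i)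
    have h4 : Ψ (b i * μ) (b i) = b i * Ψ μ 1 := by
      have := hsmul (b i) μ 1 hbi
      rwa [mul_one] at this
    have h5 := mul_le_mul_of_nonneg_left h1 hbi
    have h6 := mul_le_mul_of_nonneg_left h2 hbi
    have h7 := hlo i hi
    have h8 := hhi i hi
    have h9 := mul_le_mul_of_nonneg_left hw hbi
    have h10 := mul_le_mul_of_nonneg_left h8 hε
    have h11 : |b i * μ - a i| ≤ ε * (b i - a i) + δ * b i := by
      rw [abs_le]
      constructor <;> nlinarith
    rw [h4] at h3
    linarith

theorem cutTo_width {ε δ : ℝ} (hε : 0 < ε) (hδ : 0 ≤ δ) {m : ℕ} (hm : 1 - cut ε m ≤ δ) {t : ℕ}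
    (ht : t ≤ m) :
    cutTo ε m (t + 1) - cutTo ε m t ≤ ε * (1 - cutTo ε m (t + 1)) + δ := by
  rcases ht.eq_or_lt with rfl | h
  · simpa [cutTo] using hm
  · have h' : t + 1 ≤ m := h
    simp only [cutTo, ht, h', if_true]
    rw [cut_succ_sub hε]
    linarith

theorem max_zero_le_half (x : ℝ) : max x 0 ≤ (|x| + x) / 2 := by
  refine max_le ?_ ?_
  · linarith [le_abs_self x]
  · linarith [neg_abs_le x]

/-- The error made by sparsification, bin by bin. A low bin is a cell of slopes `y / p`, and a high
bin is a cell of slopes `p / y` with the same ends; in the bin `{1}` there is no error. -/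
theorem sum_tail_le {Φ : ℝ → ℝ → ℝ} (hΦ : IsTail Φ) {ε δ : ℝ} (hε : 0 < ε) (hδ : 0 ≤ δ) {m : ℕ}
    (hm : 1 - cut ε m ≤ δ) {R : ℝ →₀ ℝ} (hR : IsRatio R) :
    ∑ i ∈ points R, Φ (ptMoment R i) (ptMass R i) ≤
      ∑ c ∈ Finset.range (2 * m + 3), Φ (binMoment ε m R c) (binMass ε m R c) +
        ∑ i ∈ points R, (ε * |ptMass R i - ptMoment R i| +
          δ * (ptMass R i + ptMoment R i)) / 2 := by
  rw [← sum_bins (ε := ε) (m := m), ← sum_bins (ε := ε) (m := m) R (fun i => (_ + _) / 2),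
    ← Finset.sum_add_distrib]
  refine Finset.sum_le_sum fun c hc => ?_
  have hc := Finset.mem_range.mp hc
  rw [binMoment_eq_sum, binMass_eq_sum]
  set s := {i ∈ points R | ptBin ε m i = c} with hs
  have hmem : ∀ i ∈ s, i ∈ points R ∧ ptBin ε m i = c := fun i hi => by simpa [hs] using hi
  have hp : ∀ i ∈ s, 0 ≤ ptMass R i := fun i _ => ptMass_nonneg hR i
  have hy : ∀ i ∈ s, 0 ≤ ptMoment R i := fun i hi => ptMoment_nonneg hR (hmem i hi).1
  rcases lt_trichotomy c (m + 1) with h | h | h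
  · have spec : ∀ i ∈ s, cutTo ε m c * ptMass R i ≤ ptMoment R i ∧
        ptMoment R i ≤ cutTo ε m (c + 1) * ptMass R i := by
      intro i hi
      obtain ⟨h1, h2⟩ := hmem i hi
      have := ptBin_spec hε m hR h1
      rw [h2] at this
      rcases this with h3 | h3 | ⟨t, ht, h3, _⟩
      · exact h3.2
      · omega
      · omega
    refine (cell_error (σ := 1) hp (fun i hi => (spec i hi).1) (fun i hi => (spec i hi).2) hε.le
      (cutTo_width hε hδ hm (by omega)) hΦ.smul fun x x' y => ?_).trans ?_
    · have := hΦ.left x x' y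
      have := max_zero_le_half (x' - x)
      linarith
    · gcongr with i hi
      · exact le_abs_self _
      · linarith [hy i hi]
  · have spec : ∀ i ∈ s, ptMoment R i = ptMass R i := by
      intro i hi
      obtain ⟨h1, h2⟩ := hmem i hi
      have := ptBin_spec hε m hR h1
      rw [h2] at this
      rcases this with h3 | h3 | ⟨t, ht, h3, _⟩
      · omega
      · exact h3.2
      · omega
    have hdiag : ∀ x, 0 ≤ x → Φ x x = x * Φ 1 1 := fun x hx => by
      have := hΦ.smul x 1 1 hx
      rwa [mul_one] at this
    rw [Finset.sum_congr rfl spec, hdiag _ (Finset.sum_nonneg hp), Finset.sum_mul]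
    rw [Finset.sum_congr rfl fun i hi => by rw [spec i hi, hdiag _ (hp i hi)]]
    refine le_add_of_nonneg_right (Finset.sum_nonneg fun i hi => ?_)
    have := hp i hi
    have := hy i hi
    positivity
  · have spec : ∀ i ∈ s, cutTo ε m (2 * m + 2 - c) * ptMoment R i ≤ ptMass R i ∧
        ptMass R i ≤ cutTo ε m (2 * m + 2 - c + 1) * ptMoment R i := by
      intro i hi
      obtain ⟨h1, h2⟩ := hmem i hi
      have := ptBin_spec hε m hR h1
      rw [h2] at this
      rcases this with h3 | h3 | ⟨t, ht, h3, h4⟩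
      · omega
      · omega
      · have e : 2 * m + 2 - c = t := by omega
        rwa [e]
    refine (cell_error (σ := -1) (Ψ := fun x y => Φ y x) hy (fun i hi => (spec i hi).1)
      (fun i hi => (spec i hi).2) hε.le (cutTo_width hε hδ hm (by omega))
      (fun a x y ha => hΦ.smul a y x ha) fun x x' y => ?_).trans ?_
    · have h1 := hΦ.right y x x'
      have h2 := max_zero_le_half (x - x')
      rw [abs_sub_comm] at h2
      linarith
    · gcongr with i hi
      · exact le_abs.mpr (.inr (by linarith))
      · linarith [hp i hi]

/-- Adding up the vectors of a bin does not change `∑ max (p - y) 0`, because no bin contains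
points on both sides of `1`. -/
theorem sum_bins_tv {ε : ℝ} (hε : 0 < ε) (m : ℕ) {R : ℝ →₀ ℝ} (hR : IsRatio R) :
    ∑ c ∈ Finset.range (2 * m + 3), max (binMass ε m R c - binMoment ε m R c) 0 =
      ∑ i ∈ points R, max (ptMass R i - ptMoment R i) 0 := by
  rw [← sum_bins (ε := ε) (m := m)]
  refine Finset.sum_congr rfl fun c _ => ?_
  rw [binMoment_eq_sum, binMass_eq_sum, ← Finset.sum_sub_distrib]
  set s := {i ∈ points R | ptBin ε m i = c} with hs
  have hmem : ∀ i ∈ s, i ∈ points R ∧ ptBin ε m i = c := fun i hi => by simpa [hs] using hi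
  rcases le_or_gt c (m + 1) with h | h
  · have : ∀ i ∈ s, 0 ≤ ptMass R i - ptMoment R i := by
      intro i hi
      obtain ⟨h1, h2⟩ := hmem i hi
      have h0 := ptMass_nonneg hR i
      have := ptBin_spec hε m hR h1
      rw [h2] at this
      rcases this with h3 | h3 | ⟨t, ht, h3, _⟩
      · have := mul_le_mul_of_nonneg_right (cutTo_le_one hε m (c + 1)) h0
        linarith [h3.2.2]
      · linarith [h3.2]
      · omega
    rw [max_eq_left (Finset.sum_nonneg this)]
    exact Finset.sum_congr rfl fun i hi => (max_eq_left (this i hi)).symm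
  · have : ∀ i ∈ s, ptMass R i - ptMoment R i ≤ 0 := by
      intro i hi
      obtain ⟨h1, h2⟩ := hmem i hi
      have h0 := ptMoment_nonneg hR h1
      have := ptBin_spec hε m hR h1
      rw [h2] at this
      rcases this with h3 | h3 | ⟨t, ht, h3, h4⟩
      · omega
      · omega
      · have := mul_le_mul_of_nonneg_right (cutTo_le_one hε m (t + 1)) h0
        linarith [h4.2]
    rw [max_eq_right (Finset.sum_nonpos this)]
    exact (Finset.sum_eq_zero fun i hi => max_eq_right (this i hi)).symm

/-- The vectors of the bins are sorted by slope. -/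
theorem bins_sorted {ε : ℝ} (hε : 0 < ε) (m : ℕ) {R : ℝ →₀ ℝ} (hR : IsRatio R) {b b' : ℕ}
    (hbb : b < b') :
    binMoment ε m R b * binMass ε m R b' ≤ binMoment ε m R b' * binMass ε m R b := by
  have key : ∀ i ∈ points R, ∀ i' ∈ points R, ptBin ε m i = b → ptBin ε m i' = b' →
      ptMoment R i * ptMass R i' ≤ ptMoment R i' * ptMass R i := by
    intro i hi i' hi' hb hb'
    have hp := ptMass_nonneg hR i
    have hp' := ptMass_nonneg hR i'
    have hy := ptMoment_nonneg hR hi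
    have hy' := ptMoment_nonneg hR hi'
    rcases i with _ | r
    · have := ptBin_lt ε m i'
      simp only [ptBin] at hb
      omega
    · rcases i' with _ | r'
      · simp only [ptMass, mul_zero]
        exact mul_nonneg hy' hp
      · simp only [ptBin] at hb hb'
        have hrr : r ≤ r' := by
          by_contra h
          have := bin_mono hε m (not_le.mp h).le
          omega
        simp only [ptMass, ptMoment] at *
        nlinarith [mul_le_mul_of_nonneg_left hrr (mul_nonneg hp hp')]
  rw [binMoment_eq_sum, binMass_eq_sum, binMoment_eq_sum, binMass_eq_sum, Finset.sum_mul_sum,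
    Finset.sum_mul_sum, Finset.sum_comm]
  refine Finset.sum_le_sum fun i' hi' => Finset.sum_le_sum fun i hi => ?_
  simp only [Finset.mem_filter] at hi hi'
  exact key i hi.1 i' hi'.1 hi.2 hi'.2

theorem binMass_nonneg (ε : ℝ) (m : ℕ) {R : ℝ →₀ ℝ} (hR : IsRatio R) (c : ℕ) :
    0 ≤ binMass ε m R c := by
  rw [binMass_eq_sum]
  exact Finset.sum_nonneg fun i _ => ptMass_nonneg hR i

theorem binMoment_nonneg (ε : ℝ) (m : ℕ) {R : ℝ →₀ ℝ} (hR : IsRatio R) (c : ℕ) :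
    0 ≤ binMoment ε m R c := by
  rw [binMoment_eq_sum]
  exact Finset.sum_nonneg fun i hi => ptMoment_nonneg hR (Finset.mem_filter.mp hi).1

theorem isRatio_binRatio (ε : ℝ) (m : ℕ) {R : ℝ →₀ ℝ} (hR : IsRatio R) :
    IsRatio (binRatio m (binMoment ε m R) (binMass ε m R)) where
  nonneg f hf := by
    rw [expect_binRatio]
    exact Finset.sum_nonneg fun c _ => mul_nonneg (binMass_nonneg ε m hR c)
      (hf _ (div_nonneg (binMoment_nonneg ε m hR c) (binMass_nonneg ε m hR c)))
  mass := by
    rw [expect_binRatio]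
    simp only [mul_one, binMass_eq_sum]
    rw [sum_bins, sum_ptMass hR]
  mean := by
    rw [expect_binRatio, ← sum_ptMoment R, ← sum_bins (ε := ε) (m := m)]
    refine Finset.sum_le_sum fun c _ => ?_
    rw [← binMoment_eq_sum]
    rcases eq_or_ne (binMass ε m R c) 0 with h | h
    · rw [h, zero_mul]
      exact binMoment_nonneg ε m hR c
    · rw [mul_div_cancel₀ _ h]

theorem IsRatio.sparsify {ε : ℝ} (hε : 0 < ε) (δ : ℝ) {R : ℝ →₀ ℝ} (hR : IsRatio R) :
    IsRatio (sparsify R ε δ) := by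
  rw [sparsify_eq hε δ hR.support_nonneg]
  exact isRatio_binRatio _ _ hR

theorem expect_tail_eq_sum_points {Φ : ℝ → ℝ → ℝ} (hΦ : IsTail Φ) {R : ℝ →₀ ℝ} (hR : IsRatio R) :
    expect (fun r => Φ r 1) R = ∑ i ∈ points R, Φ (ptMoment R i) (ptMass R i) := by
  rw [points, Finset.sum_insertNone, expect_eq_sum]
  simp only [ptMoment, ptMass]
  rw [hΦ.zero_right _ (sub_nonneg.mpr hR.mean), zero_add]
  refine Finset.sum_congr rfl fun r _ => ?_
  rw [← hΦ.smul _ _ _ (hR.apply_nonneg r), mul_one]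

theorem expect_tail_binRatio {Φ : ℝ → ℝ → ℝ} (hΦ : IsTail Φ) (ε : ℝ) (m : ℕ) {R : ℝ →₀ ℝ}
    (hR : IsRatio R) :
    expect (fun r => Φ r 1) (binRatio m (binMoment ε m R) (binMass ε m R)) =
      ∑ c ∈ Finset.range (2 * m + 3), Φ (binMoment ε m R c) (binMass ε m R c) := by
  rw [expect_binRatio]
  refine Finset.sum_congr rfl fun c _ => ?_
  rcases eq_or_ne (binMass ε m R c) 0 with h | h
  · rw [h, zero_mul, hΦ.zero_right _ (binMoment_nonneg ε m hR c)]
  · rw [← hΦ.smul _ _ _ (binMass_nonneg ε m hR c), mul_one, mul_div_cancel₀ _ h]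

theorem expect_tail_sparsify_le {Φ : ℝ → ℝ → ℝ} (hΦ : IsTail Φ) {ε : ℝ} (hε : 0 < ε) (δ : ℝ)
    {R : ℝ →₀ ℝ} (hR : IsRatio R) :
    expect (fun r => Φ r 1) (sparsify R ε δ) ≤ expect (fun r => Φ r 1) R := by
  rw [sparsify_eq hε δ hR.support_nonneg, expect_tail_binRatio hΦ _ _ hR,
    expect_tail_eq_sum_points hΦ hR, ← sum_bins (ε := ε) (m := numIntervals ε δ)]
  refine Finset.sum_le_sum fun c _ => ?_
  rw [binMoment_eq_sum, binMass_eq_sum]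
  exact hΦ.sum_le _ _ _

/-- For a positive `δ`, fewer than `numIntervals ε δ` steps of growth by the factor `1 + ε` do not
bring `δ` to `1`. -/
theorem lt_numIntervals_iff {ε δ : ℝ} (hε : 0 < ε) (hδ : 0 < δ) (k : ℕ) :
    k < numIntervals ε δ ↔ δ * (1 + ε) ^ k < 1 := by
  have h1 : 0 < Real.log (1 + ε) := Real.log_pos (by linarith)
  have h2 : (0 : ℝ) < (1 + ε) ^ k := by positivity
  rw [numIntervals, Nat.lt_ceil, lt_div_iff₀ h1, ← Real.log_neg_iff (mul_pos hδ h2),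
    Real.log_mul hδ.ne' h2.ne', Real.log_pow]
  constructor <;> intro h <;> linarith

theorem one_sub_cut_numIntervals_le {ε δ : ℝ} (hε : 0 < ε) (hδ : 0 < δ) :
    1 - cut ε (numIntervals ε δ) ≤ δ := by
  have h := (lt_numIntervals_iff hε hδ (numIntervals ε δ)).not.mp (lt_irrefl _)
  have h2 : (0 : ℝ) < (1 + ε) ^ (numIntervals ε δ) := by positivity
  rw [cut, sub_sub_cancel, inv_eq_one_div, div_le_iff₀ h2]
  exact not_lt.mp h

/-- The error made by sparsification is at most `ε * Δ + δ`, where `Δ` is the total variation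
distance encoded by the ratio. -/
theorem expect_tail_le_sparsify {Φ : ℝ → ℝ → ℝ} (hΦ : IsTail Φ) {ε δ : ℝ} (hε : 0 < ε)
    (hδ : 0 < δ) {R : ℝ →₀ ℝ} (hR : IsRatio R) :
    expect (fun r => Φ r 1) R ≤
      expect (fun r => Φ r 1) (sparsify R ε δ) + (ε * tvRatio R + δ) := by
  rw [sparsify_eq hε δ hR.support_nonneg, expect_tail_binRatio hΦ _ _ hR,
    expect_tail_eq_sum_points hΦ hR, tvRatio_eq_expect,
    expect_tail_eq_sum_points isTail_base hR]
  refine (sum_tail_le hΦ hε hδ.le (one_sub_cut_numIntervals_le hε hδ) hR).trans ?_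
  gcongr
  -- The vectors of a ratio add up to `(1, 1)`, so that `∑ |p - y| = 2 * ∑ max (p - y) 0`.
  have e : ∀ x : ℝ, |x| = 2 * max x 0 - x := fun x => by
    rcases le_total 0 x with h | h
    · rw [abs_of_nonneg h, max_eq_left h]; ring
    · rw [abs_of_nonpos h, max_eq_right h]; ring
  simp only [e, ← Finset.sum_div, Finset.sum_add_distrib, ← Finset.mul_sum,
    Finset.sum_sub_distrib, sum_ptMass hR, sum_ptMoment R]
  linarith

/-! ### Total variation distance of products -/

theorem tvDist_eq_sum_max {Ω : Type*} [Fintype Ω] {P Q : Ω → ℝ} (h : ∑ x, P x = ∑ x, Q x) :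
    tvDist P Q = ∑ x, max (Q x - P x) 0 := by
  have e : ∀ x, |P x - Q x| = 2 * max (Q x - P x) 0 - (Q x - P x) := fun x => by
    rcases le_total (P x) (Q x) with h | h
    · rw [abs_of_nonpos (by linarith), max_eq_left (by linarith)]; ring
    · rw [abs_of_nonneg (by linarith), max_eq_right (by linarith)]; ring
  simp only [tvDist, e, Finset.sum_sub_distrib, ← Finset.mul_sum, h]
  ring

theorem tvDist_nonneg {Ω : Type*} [Fintype Ω] (P Q : Ω → ℝ) : 0 ≤ tvDist P Q := by
  unfold tvDist
  positivity

/-- The function `(y, p) ↦ ∑ x, max (p * Q x - y * P x) 0` for the products `P`, `Q` of the `l`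
rows of two tables that follow row `k`, row `k` included; see `tail_eq_sum`. -/
def tail {q : ℕ} (P Q : ℕ → Fin q → ℝ) : ℕ → ℕ → ℝ → ℝ → ℝ
  | 0, _, y, p => max (p - y) 0
  | l + 1, k, y, p => ∑ j, tail P Q l (k + 1) (y * P k j) (p * Q k j)

theorem isTail_tail {q : ℕ} {P Q : ℕ → Fin q → ℝ} (hP : ∀ i, P i ∈ stdSimplex ℝ (Fin q))
    (hQ : ∀ i, Q i ∈ stdSimplex ℝ (Fin q)) (l k : ℕ) : IsTail (tail P Q l k) := by
  induction l generalizing k with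
  | zero => exact isTail_base
  | succ l ih => exact (ih (k + 1)).step (hP k) (hQ k)

theorem tail_eq_sum {q : ℕ} (P Q : ℕ → Fin q → ℝ) (l k : ℕ) (y p : ℝ) :
    tail P Q l k y p = ∑ x : Fin l → Fin q,
      max (p * ∏ i : Fin l, Q (k + i) (x i) - y * ∏ i : Fin l, P (k + i) (x i)) 0 := by
  induction l generalizing k y p with
  | zero => simp [tail]
  | succ l ih =>
    rw [tail, ← (Fin.consEquiv fun _ => Fin q).sum_comp, Fintype.sum_prod_type]
    refine Finset.sum_congr rfl fun j _ => ?_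
    rw [ih]
    refine Finset.sum_congr rfl fun x _ => ?_
    simp only [Fin.consEquiv_apply, Fin.prod_univ_succ, Fin.cons_zero, Fin.cons_succ, Fin.val_zero,
      Fin.val_succ, add_zero, mul_assoc, add_assoc, add_comm 1]

/-- The total variation distance is subadditive under products. -/
theorem tail_le_add {q : ℕ} {P Q : ℕ → Fin q → ℝ} (hP : ∀ i, P i ∈ stdSimplex ℝ (Fin q))
    (hQ : ∀ i, Q i ∈ stdSimplex ℝ (Fin q)) (l k : ℕ) {y p : ℝ} (hy : 0 ≤ y) :
    tail P Q l k y p ≤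
      max (p - y) 0 + y * ∑ i ∈ Finset.range l, tvDist (P (k + i)) (Q (k + i)) := by
  have step : ∀ l k (y p : ℝ), 0 ≤ y →
      tail P Q (l + 1) k y p ≤ y * tvDist (P k) (Q k) +
        ∑ j, tail P Q l (k + 1) (y * Q k j) (p * Q k j) := by
    intro l k y p hy
    rw [tvDist_eq_sum_max ((hP k).2.trans (hQ k).2.symm), Finset.mul_sum,
      ← Finset.sum_add_distrib, tail]
    refine Finset.sum_le_sum fun j _ => ?_
    have := (isTail_tail hP hQ l (k + 1)).left (y * P k j) (y * Q k j) (p * Q k j)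
    rw [← mul_sub, ← mul_zero y, ← mul_max_of_nonneg _ _ hy] at this
    linarith
  induction l generalizing k y p with
  | zero => simp [tail]
  | succ l ih =>
    refine (step l k y p hy).trans ?_
    have h := isTail_tail hP hQ l (k + 1)
    have e : ∑ j, tail P Q l (k + 1) (y * Q k j) (p * Q k j) = tail P Q l (k + 1) y p := by
      rw [← one_mul (tail P Q l (k + 1) y p), ← (hQ k).2, Finset.sum_mul]
      refine Finset.sum_congr rfl fun j _ => ?_
      rw [mul_comm y, mul_comm p, h.smul _ _ _ ((hQ k).1 j)]
    rw [e, Finset.sum_range_succ']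
    have := ih (k + 1) (p := p) hy
    simp only [add_assoc, add_comm 1, add_zero] at this ⊢
    linarith

theorem tvDist_row_le_tail {q : ℕ} {P Q : ℕ → Fin q → ℝ} (hP : ∀ i, P i ∈ stdSimplex ℝ (Fin q))
    (hQ : ∀ i, Q i ∈ stdSimplex ℝ (Fin q)) {l i : ℕ} (hi : i < l) (k : ℕ) :
    tvDist (P (k + i)) (Q (k + i)) ≤ tail P Q l k 1 1 := by
  induction l generalizing k i with
  | zero => omega
  | succ l ih =>
    have h := isTail_tail hP hQ l (k + 1)
    simp only [tail, one_mul]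
    rcases i with _ | i
    · rw [add_zero, tvDist_eq_sum_max ((hP k).2.trans (hQ k).2.symm)]
      exact Finset.sum_le_sum fun j _ => h.lower _ _
    · have h1 := h.sum_le Finset.univ (fun j => P k j) (fun j => Q k j)
      rw [(hP k).2, (hQ k).2] at h1
      have h2 := ih (i := i) (by omega) (k + 1)
      rw [show k + 1 + i = k + (i + 1) by omega] at h2
      exact h2.trans h1

/-- The rows of a nonempty table, continued by copies of the last row. -/
def extendRows {n q : ℕ} (hn : 0 < n) (P : Fin n → Fin q → ℝ) (i : ℕ) : Fin q → ℝ :=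
  P ⟨min i (n - 1), by omega⟩

theorem extendRows_of_lt {n q : ℕ} (hn : 0 < n) (P : Fin n → Fin q → ℝ) {i : ℕ} (hi : i < n) :
    extendRows hn P i = P ⟨i, hi⟩ := by
  have : min i (n - 1) = i := by omega
  simp only [extendRows, this]

theorem sum_prodDist {n q : ℕ} {P : Fin n → Fin q → ℝ} (hP : ∀ i, P i ∈ stdSimplex ℝ (Fin q)) :
    ∑ x, prodDist P x = 1 := by
  have h := Finset.prod_univ_sum (fun _ : Fin n => (Finset.univ : Finset (Fin q))) P
  rw [Fintype.piFinset_univ] at h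
  simp only [prodDist, ← h, (hP _).2, Finset.prod_const_one]

theorem tvDist_prodDist_eq_tail {n q : ℕ} (hn : 0 < n) {P Q : Fin n → Fin q → ℝ}
    (hP : ∀ i, P i ∈ stdSimplex ℝ (Fin q)) (hQ : ∀ i, Q i ∈ stdSimplex ℝ (Fin q)) :
    tvDist (prodDist P) (prodDist Q) = tail (extendRows hn P) (extendRows hn Q) n 0 1 1 := by
  rw [tvDist_eq_sum_max ((sum_prodDist hP).trans (sum_prodDist hQ).symm), tail_eq_sum]
  refine Finset.sum_congr rfl fun x _ => ?_
  have e : ∀ (M : Fin n → Fin q → ℝ) (i : Fin n), extendRows hn M i = M i := fun M i =>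
    extendRows_of_lt hn M i.2
  simp only [zero_add, one_mul, e, prodDist]

section Product

variable {n q : ℕ} {P Q : Fin n → Fin q → ℝ} (hP : ∀ i, P i ∈ stdSimplex ℝ (Fin q))
  (hQ : ∀ i, Q i ∈ stdSimplex ℝ (Fin q))

include hP hQ

theorem tvDist_prodDist_le_one (hn : 0 < n) : tvDist (prodDist P) (prodDist Q) ≤ 1 := by
  rw [tvDist_prodDist_eq_tail hn hP hQ]
  have h := isTail_tail (P := extendRows hn P) (Q := extendRows hn Q) (fun i => hP _)
    (fun i => hQ _) n 0
  have h1 := h.right 1 1 0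
  rw [h.zero_right 1 zero_le_one] at h1
  simpa using h1

theorem tvDist_le_prodDist (i : Fin n) :
    tvDist (P i) (Q i) ≤ tvDist (prodDist P) (prodDist Q) := by
  have hn : 0 < n := i.pos
  have h := tvDist_row_le_tail (P := extendRows hn P) (Q := extendRows hn Q) (fun i => hP _)
    (fun i => hQ _) i.2 0
  rwa [zero_add, extendRows_of_lt hn P i.2, extendRows_of_lt hn Q i.2,
    ← tvDist_prodDist_eq_tail hn hP hQ] at h

theorem lowerBound_le (hn : 0 < n) : lowerBound P Q ≤ tvDist (prodDist P) (prodDist Q) := by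
  have : Nonempty (Fin n) := ⟨⟨0, hn⟩⟩
  exact ciSup_le fun i => tvDist_le_prodDist hP hQ i

theorem le_mul_lowerBound (hn : 0 < n) :
    tvDist (prodDist P) (prodDist Q) ≤ n * lowerBound P Q := by
  rw [tvDist_prodDist_eq_tail hn hP hQ]
  refine (tail_le_add (fun i => hP _) (fun i => hQ _) n 0 zero_le_one).trans ?_
  rw [sub_self, max_self, zero_add, one_mul]
  refine (Finset.sum_le_card_nsmul _ _ (lowerBound P Q) fun i hi => ?_).trans_eq ?_
  · exact le_ciSup (f := fun i => tvDist (P i) (Q i)) (Set.finite_range _).bddAbove _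
  · simp

end Product

theorem lowerBound_nonneg {n q : ℕ} (P Q : Fin n → Fin q → ℝ) : 0 ≤ lowerBound P Q :=
  Real.iSup_nonneg fun _ => tvDist_nonneg _ _

/-! ### The error of the approximate ratios -/

theorem expect_tail_mulIndep {Φ : ℝ → ℝ → ℝ} (hΦ : IsTail Φ) {R : ℝ →₀ ℝ} (hR : IsRatio R)
    {q : ℕ} {P Q : Fin q → ℝ} (hP : P ∈ stdSimplex ℝ (Fin q)) (hQ : Q ∈ stdSimplex ℝ (Fin q)) :
    expect (fun r => Φ r 1) (mulIndep R (ratioFin P Q)) =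
      expect (fun r => ∑ j, Φ (r * P j) (1 * Q j)) R := by
  rw [expect_mulIndep, expect_eq_sum, expect_eq_sum]
  refine Finset.sum_congr rfl fun r hr => ?_
  rw [expect_ratioFin]
  congr 1
  refine Finset.sum_congr rfl fun j _ => ?_
  rcases eq_or_ne (Q j) 0 with h | h
  · rw [h, zero_mul, mul_zero, hΦ.zero_right _ (mul_nonneg (hR.support_nonneg r hr) (hP.1 j))]
  · rw [← hΦ.smul _ _ _ (hQ.1 j), mul_one, one_mul]
    congr 1
    field_simp

theorem isRatio_single_one : IsRatio (Finsupp.single 1 1) where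
  nonneg f hf := by simpa using hf 1 zero_le_one
  mass := by simp
  mean := by simp

theorem mulIndep_single_one (S : ℝ →₀ ℝ) : mulIndep (Finsupp.single 1 1) S = S := by
  rw [mulIndep, Finsupp.sum_single_index]
  · simp only [one_mul]
    exact S.sum_single
  · simp

theorem isRatio_approxRatio {n q : ℕ} {P Q : Fin n → Fin q → ℝ}
    (hP : ∀ i, P i ∈ stdSimplex ℝ (Fin q)) (hQ : ∀ i, Q i ∈ stdSimplex ℝ (Fin q)) {ε : ℝ}
    (hε : 0 < ε) (k : ℕ) (hk : k < n) : IsRatio (approxRatio P Q ε k hk) := by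
  induction k with
  | zero => exact .ratioFin (hP _) (hQ _)
  | succ k ih =>
    have hn : (0 : ℝ) < n := by exact_mod_cast (Nat.zero_lt_of_lt hk)
    exact ((ih (Nat.lt_of_succ_lt hk)).sparsify (by positivity) _).mulIndep
      (.ratioFin (hP _) (hQ _))

/-- The output of the algorithm is at most the true distance, and the error is relative. The
distances of the hybrids, in which the first `k + 1` coordinates are represented by their
approximate ratio and the others are exact, decrease with `k`, by at most
`ε / (2 * n) * (Δ + d) ≤ ε / n * Δ` each time. -/
theorem algorithmOutput_bounds {n q : ℕ} (hn : 0 < n) {P Q : Fin n → Fin q → ℝ}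
    (hP : ∀ i, P i ∈ stdSimplex ℝ (Fin q)) (hQ : ∀ i, Q i ∈ stdSimplex ℝ (Fin q)) {ε : ℝ}
    (hε : 0 < ε) :
    (1 - ε) * tvDist (prodDist P) (prodDist Q) ≤ algorithmOutput hn P Q ε ∧
      algorithmOutput hn P Q ε ≤ tvDist (prodDist P) (prodDist Q) := by
  have hnR : (0 : ℝ) < n := by exact_mod_cast hn
  set Δ := tvDist (prodDist P) (prodDist Q) with hΔ
  set d := lowerBound P Q with hd
  set e := ε / (2 * n) with he
  have he0 : 0 < e := by positivity
  have hd0 : 0 ≤ d := lowerBound_nonneg P Q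
  have hdΔ : d ≤ Δ := lowerBound_le hP hQ hn
  have hΔd : Δ ≤ n * d := le_mul_lowerBound hP hQ hn
  set P' := extendRows hn P with hP'
  set Q' := extendRows hn Q with hQ'
  have hPs : ∀ i, P' i ∈ stdSimplex ℝ (Fin q) := fun i => hP _
  have hQs : ∀ i, Q' i ∈ stdSimplex ℝ (Fin q) := fun i => hQ _
  have hT := isTail_tail hPs hQs
  have hR := isRatio_approxRatio hP hQ hε
  let H : ∀ k, k < n → ℝ := fun k hk =>
    expect (fun r => tail P' Q' (n - 1 - k) (k + 1) r 1) (approxRatio P Q ε k hk)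
  have hH0 : ∀ h0 : 0 < n, H 0 h0 = Δ := by
    intro h0
    have h1 := expect_tail_mulIndep (hT (n - 1) 1) isRatio_single_one (hP ⟨0, h0⟩) (hQ ⟨0, h0⟩)
    rw [mulIndep_single_one] at h1
    rw [hΔ, tvDist_prodDist_eq_tail hn hP hQ]
    obtain ⟨l, rfl⟩ : ∃ l, n = l + 1 := ⟨n - 1, by omega⟩
    refine h1.trans ?_
    rw [expect_single, one_mul, tail, extendRows_of_lt hn P h0, extendRows_of_lt hn Q h0]
    rfl
  have hHs : ∀ k (hk : k + 1 < n), H (k + 1) hk =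
      expect (fun r => tail P' Q' (n - 1 - k) (k + 1) r 1)
        (sparsify (approxRatio P Q ε k (Nat.lt_of_succ_lt hk)) e (e * d)) := by
    intro k hk
    have h1 := expect_tail_mulIndep (hT (n - 1 - (k + 1)) (k + 1 + 1))
      ((hR k (Nat.lt_of_succ_lt hk)).sparsify he0 (e * d)) (hP ⟨k + 1, hk⟩) (hQ ⟨k + 1, hk⟩)
    refine h1.trans ?_
    rw [show n - 1 - k = n - 1 - (k + 1) + 1 by omega]
    simp only [tail]
    rw [hP', hQ', extendRows_of_lt hn P hk, extendRows_of_lt hn Q hk]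
  have hup : ∀ k (hk : k < n), H k hk ≤ Δ := by
    intro k
    induction k with
    | zero => exact fun hk => (hH0 hk).le
    | succ k ih =>
      intro hk
      rw [hHs k hk]
      exact (expect_tail_sparsify_le (hT _ _) he0 _ (hR k _)).trans (ih _)
  have htv : ∀ k (hk : k < n), tvRatio (approxRatio P Q ε k hk) ≤ Δ := by
    intro k hk
    refine le_trans ?_ (hup k hk)
    rw [tvRatio_eq_expect, expect_eq_sum]
    simp only [H, expect_eq_sum]
    exact Finset.sum_le_sum fun r _ =>
      mul_le_mul_of_nonneg_left ((hT _ _).lower _ _) ((hR k hk).apply_nonneg r)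
  have hlow : 0 < d → ∀ k (hk : k < n), Δ - k * (2 * e * Δ) ≤ H k hk := by
    intro hd1 k
    induction k with
    | zero =>
      intro hk
      rw [hH0 hk]
      simp
    | succ k ih =>
      intro hk
      have hk' := Nat.lt_of_succ_lt hk
      have h1 := ih hk'
      have h2 := expect_tail_le_sparsify (hT (n - 1 - k) (k + 1)) he0 (mul_pos he0 hd1) (hR k hk')
      rw [← hHs k hk] at h2
      have h3 := mul_le_mul_of_nonneg_left (htv k hk') he0.le
      have h4 := mul_le_mul_of_nonneg_left hdΔ he0.le
      push_cast
      simp only [H] at h1 h2 ⊢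
      linarith
  have hlast : ∀ h, H (n - 1) h = algorithmOutput hn P Q ε := by
    intro h
    rw [algorithmOutput, tvRatio_eq_expect]
    simp only [H, Nat.sub_self, tail]
  have hlt : n - 1 < n := by omega
  rw [← hlast hlt]
  refine ⟨?_, hup _ _⟩
  rcases hd0.eq_or_lt with h | h
  · rw [← h, mul_zero] at hΔd
    have : Δ = 0 := le_antisymm hΔd (hd0.trans hdΔ)
    rw [this, mul_zero]
    exact (hR _ _).nonneg _ fun r _ => (hT _ _).nonneg _ _
  · refine le_trans ?_ (hlow h _ hlt)
    have h5 : ((n - 1 : ℕ) : ℝ) ≤ n := by exact_mod_cast Nat.sub_le n 1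
    have h6 : (n : ℝ) * (2 * e) = ε := by rw [he]; field_simp
    have h7 : 0 ≤ 2 * e * Δ := by have := hd0.trans hdΔ; positivity
    have := mul_le_mul_of_nonneg_right h5 h7
    nlinarith

/-! ### The rounds of the algorithm in terms of bins -/

/-- The ratio after `k` rounds, where a round sparsifies and then multiplies by the ratio of the
next row. The first round starts from the trivial ratio, on which sparsification has no effect. -/
def roundRatio (ε : ℝ) (m : ℕ) {q : ℕ} (P Q : ℕ → Fin q → ℝ) : ℕ → (ℝ →₀ ℝ)
  | 0 => Finsupp.single 1 1
  | k + 1 =>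
      let R := roundRatio ε m P Q k
      mulIndep (binRatio m (binMoment ε m R) (binMass ε m R)) (ratioFin (P k) (Q k))

theorem isRatio_roundRatio (ε : ℝ) (m : ℕ) {q : ℕ} {P Q : ℕ → Fin q → ℝ}
    (hP : ∀ i, P i ∈ stdSimplex ℝ (Fin q)) (hQ : ∀ i, Q i ∈ stdSimplex ℝ (Fin q)) (k : ℕ) :
    IsRatio (roundRatio ε m P Q k) := by
  induction k with
  | zero => exact isRatio_single_one
  | succ k ih => exact (isRatio_binRatio ε m ih).mulIndep (.ratioFin (hP k) (hQ k))

theorem bin_one (ε : ℝ) (m : ℕ) (hε : 0 < ε) : bin ε m 1 = m + 1 := by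
  have h1 : Beyond ε m m 1 := by
    rw [Beyond, if_pos le_rfl]
    exact cutTo_le_one hε m _
  have h2 : ¬ Beyond ε m (m + 1) 1 := by
    rw [Beyond, if_neg (by omega), mul_one, not_lt]
    exact cutTo_le_one hε m _
  rw [← lt_bin_iff hε zero_le_one] at h1 h2
  omega

theorem binMass_single_one {ε : ℝ} (hε : 0 < ε) (m c : ℕ) :
    binMass ε m (Finsupp.single 1 1) c = if c = m + 1 then 1 else 0 := by
  rw [binMass, expect_single, bin_one ε m hε, one_mul]
  simp only [eq_comm]

theorem binMoment_single_one {ε : ℝ} (hε : 0 < ε) (m c : ℕ) :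
    binMoment ε m (Finsupp.single 1 1) c = if c = m + 1 then 1 else 0 := by
  rw [binMoment, expect_single, expect_single, bin_one ε m hε, one_mul, one_mul, sub_self, ite_self,
    add_zero]
  simp only [eq_comm]

theorem roundRatio_succ_eq_approxRatio {n q : ℕ} (hn : 0 < n) {P Q : Fin n → Fin q → ℝ}
    (hP : ∀ i, P i ∈ stdSimplex ℝ (Fin q)) (hQ : ∀ i, Q i ∈ stdSimplex ℝ (Fin q)) {ε : ℝ}
    (hε : 0 < ε) (k : ℕ) (hk : k < n) :
    roundRatio (ε / (2 * n)) (numIntervals (ε / (2 * n)) (ε / (2 * n) * lowerBound P Q))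
      (extendRows hn P) (extendRows hn Q) (k + 1) = approxRatio P Q ε k hk := by
  have hnR : (0 : ℝ) < n := by exact_mod_cast hn
  have he : 0 < ε / (2 * n) := by positivity
  induction k with
  | zero =>
    have e : ∀ m, binRatio m (binMoment (ε / (2 * n)) m (Finsupp.single 1 1))
        (binMass (ε / (2 * n)) m (Finsupp.single 1 1)) = Finsupp.single 1 1 := by
      intro m
      rw [binRatio, Finset.sum_eq_single (m + 1)]
      · simp [binMoment_single_one he, binMass_single_one he]
      · intro c _ hc
        simp [binMass_single_one he, hc]
      · simp
        omega
    rw [roundRatio, roundRatio, e, mulIndep_single_one, approxRatio, extendRows_of_lt hn P hk,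
      extendRows_of_lt hn Q hk]
  | succ k ih =>
    rw [roundRatio, ih (Nat.lt_of_succ_lt hk), approxRatio, extendRows_of_lt hn P hk,
      extendRows_of_lt hn Q hk,
      sparsify_eq he _ (isRatio_approxRatio hP hQ hε k _).support_nonneg]

theorem algorithmOutput_eq_sum {n q : ℕ} (hn : 0 < n) {P Q : Fin n → Fin q → ℝ}
    (hP : ∀ i, P i ∈ stdSimplex ℝ (Fin q)) (hQ : ∀ i, Q i ∈ stdSimplex ℝ (Fin q)) {ε : ℝ}
    (hε : 0 < ε) {e : ℝ} (he : e = ε / (2 * n)) {m : ℕ}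
    (hm : m = numIntervals e (e * lowerBound P Q)) {R : ℝ →₀ ℝ}
    (hR : R = roundRatio e m (extendRows hn P) (extendRows hn Q) n) :
    algorithmOutput hn P Q ε =
      ∑ c ∈ Finset.range (2 * m + 3), max (binMass e m R c - binMoment e m R c) 0 := by
  have hnR : (0 : ℝ) < n := by exact_mod_cast hn
  have he0 : 0 < e := by rw [he]; positivity
  have h1 : IsRatio R := hR ▸ isRatio_roundRatio e m (fun i => hP _) (fun i => hQ _) n
  have h2 : R = approxRatio P Q ε (n - 1) (Nat.sub_lt hn Nat.one_pos) := by
    rw [hR, hm, he, ← roundRatio_succ_eq_approxRatio hn hP hQ hε, Nat.sub_add_cancel hn]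
  rw [sum_bins_tv he0 m h1, ← expect_tail_eq_sum_points isTail_base h1, algorithmOutput, ← h2,
    tvRatio_eq_expect]

/-- The slope of the product of the vector in bin `b` with the vector `(x, z)`. -/
def slope (Y p : ℕ → ℝ) (x z : ℝ) (b : ℕ) : ℝ := Y b / p b * (x / z)

/-- What the product of the vector in bin `b` with `(x, z)` contributes to the mass of bin `c`. -/
def massPart (ε : ℝ) (m : ℕ) (Y p : ℕ → ℝ) (x z : ℝ) (b c : ℕ) : ℝ :=
  if bin ε m (slope Y p x z b) = c then p b * z else 0

/-- What the product of the vector in bin `b` with `(x, z)` contributes to the moment of bin `c`,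
if the moment of the last bin is initialized with `1`. -/
def momentPart (ε : ℝ) (m : ℕ) (Y p : ℕ → ℝ) (x z : ℝ) (b c : ℕ) : ℝ :=
  if p b * z = 0 then 0
  else (if bin ε m (slope Y p x z b) = c then Y b * x else 0) -
    if c = 2 * m + 2 then Y b * x else 0

theorem binMass_mulIndep (ε : ℝ) (m : ℕ) (Y p : ℕ → ℝ) {q : ℕ} (P Q : Fin q → ℝ) (c : ℕ) :
    binMass ε m (mulIndep (binRatio m Y p) (ratioFin P Q)) c =
      ∑ j, ∑ b ∈ Finset.range (2 * m + 3), massPart ε m Y p (P j) (Q j) b c := by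
  rw [binMass, expect_mulIndep, expect_binRatio, Finset.sum_comm]
  refine Finset.sum_congr rfl fun b _ => ?_
  rw [expect_ratioFin, Finset.mul_sum]
  refine Finset.sum_congr rfl fun j _ => ?_
  rw [massPart, slope]
  split_ifs <;> ring

theorem binMoment_mulIndep (ε : ℝ) (m : ℕ) (Y p : ℕ → ℝ) {q : ℕ} (P Q : Fin q → ℝ) (c : ℕ) :
    binMoment ε m (mulIndep (binRatio m Y p) (ratioFin P Q)) c =
      (if c = 2 * m + 2 then 1 else 0) +
        ∑ j, ∑ b ∈ Finset.range (2 * m + 3), momentPart ε m Y p (P j) (Q j) b c := by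
  have key : ∀ f : ℝ → ℝ, expect f (mulIndep (binRatio m Y p) (ratioFin P Q)) =
      ∑ j, ∑ b ∈ Finset.range (2 * m + 3), p b * Q j * f (slope Y p (P j) (Q j) b) := by
    intro f
    rw [expect_mulIndep, expect_binRatio, Finset.sum_comm]
    refine Finset.sum_congr rfl fun b _ => ?_
    rw [expect_ratioFin, Finset.mul_sum]
    exact Finset.sum_congr rfl fun j _ => by rw [slope, mul_assoc]
  have hprod : ∀ b j, p b * Q j ≠ 0 → p b * Q j * slope Y p (P j) (Q j) b = Y b * P j := by
    intro b j h
    have h1 := left_ne_zero_of_mul h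
    have h2 := right_ne_zero_of_mul h
    rw [slope]
    field_simp
  have e : ∀ b j, momentPart ε m Y p (P j) (Q j) b c =
      p b * Q j * (if bin ε m (slope Y p (P j) (Q j) b) = c then slope Y p (P j) (Q j) b else 0) -
        if c = 2 * m + 2 then p b * Q j * slope Y p (P j) (Q j) b else 0 := by
    intro b j
    rw [momentPart]
    by_cases h : p b * Q j = 0
    · simp [h]
    · rw [if_neg h, hprod b j h, mul_ite, hprod b j h, mul_zero]
  rw [binMoment, key, key]
  simp only [e, Finset.sum_sub_distrib]
  split_ifs <;> simp
  ring

/-! ### Running times and final states of programs -/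

/-- Started in state `s`, the program halts after at most `B` steps in a state satisfying `Q`. -/
def Runs (c : Program) (s : State) (B : ℕ) (Q : State → Prop) : Prop :=
  ∃ T s', Exec c s T s' ∧ T ≤ B ∧ Q s'

theorem Runs.mono {c : Program} {s : State} {B B' : ℕ} {Q Q' : State → Prop}
    (h : Runs c s B Q) (hB : B ≤ B') (hQ : ∀ s, Q s → Q' s) : Runs c s B' Q' := by
  obtain ⟨T, s', h1, h2, h3⟩ := h
  exact ⟨T, s', h1, h2.trans hB, hQ _ h3⟩

theorem Runs.seq {c₁ c₂ : Program} {s : State} {B₁ B₂ : ℕ} {Q₁ Q : State → Prop}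
    (h₁ : Runs c₁ s B₁ Q₁) (h₂ : ∀ s, Q₁ s → Runs c₂ s B₂ Q) :
    Runs (.seq c₁ c₂) s (B₁ + B₂) Q := by
  obtain ⟨T₁, s₁, h1, h2, h3⟩ := h₁
  obtain ⟨T₂, s₂, g1, g2, g3⟩ := h₂ s₁ h3
  exact ⟨_, _, .seq h1 g1, add_le_add h2 g2, g3⟩

/-- A loop whose body decreases a variant `k` makes at most `k` iterations. -/
theorem Runs.loop {b : Test} {c : Program} {B : ℕ} {Q : State → Prop} {Inv : ℕ → State → Prop}
    (step : ∀ k s, Inv k s → b.Holds s → Runs c s B fun s' => ∃ k' < k, Inv k' s')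
    (done : ∀ k s, Inv k s → ¬ b.Holds s → Q s) {k : ℕ} {s : State} (h : Inv k s) :
    Runs (.loop b c) s (k * (B + 1) + 1) Q := by
  induction k using Nat.strong_induction_on generalizing s with
  | _ k ih =>
    by_cases hb : b.Holds s
    · obtain ⟨T₁, s₁, h1, h2, k', hk', h3⟩ := step k s h hb
      obtain ⟨T₂, s₂, g1, g2, g3⟩ := ih k' hk' h3
      refine ⟨_, _, .loopStep hb h1 g1, ?_, g3⟩
      have : (k' + 1) * (B + 1) ≤ k * (B + 1) := Nat.mul_le_mul_right _ hk'
      linarith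
    · exact ⟨_, _, .loopDone hb, by omega, done k s h hb⟩

/-- An upper bound on the number of steps of a program without loops. -/
def cost : Program → ℕ
  | .seq c₁ c₂ => cost c₁ + cost c₂
  | .ite _ c₁ c₂ => max (cost c₁) (cost c₂) + 1
  | _ => 1

/-- The weakest precondition of a program without loops. -/
def wp : Program → (State → Prop) → State → Prop
  | .skip, Q, s => Q s
  | .idxConst d v, Q, s => Q (s.setIdx d v)
  | .idxAdd d a b, Q, s => Q (s.setIdx d (s.idx a + s.idx b))
  | .idxSub d a b, Q, s => Q (s.setIdx d (s.idx a - s.idx b))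
  | .regConst d v, Q, s => Q (s.setReg d v)
  | .regAdd d a b, Q, s => Q (s.setReg d (s.reg a + s.reg b))
  | .regSub d a b, Q, s => Q (s.setReg d (s.reg a - s.reg b))
  | .regMul d a b, Q, s => Q (s.setReg d (s.reg a * s.reg b))
  | .regDiv d a b, Q, s => s.reg b ≠ 0 ∧ Q (s.setReg d (s.reg a / s.reg b))
  | .load d arr i, Q, s => Q (s.setReg d (s.mem arr (s.idx i)))
  | .store arr i a, Q, s => Q (s.setMem arr (s.idx i) (s.reg a))
  | .seq c₁ c₂, Q, s => wp c₁ (wp c₂ Q) s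
  | .ite b c₁ c₂, Q, s => (b.Holds s → wp c₁ Q s) ∧ (¬ b.Holds s → wp c₂ Q s)
  | .loop _ _, _, _ => False

theorem wp_mono {c : Program} {Q Q' : State → Prop} (hQ : ∀ s, Q s → Q' s) {s : State}
    (h : wp c Q s) : wp c Q' s := by
  induction c generalizing s Q Q' with
  | seq c₁ c₂ ih₁ ih₂ => exact ih₁ (fun _ h' => ih₂ hQ h') h
  | ite b c₁ c₂ ih₁ ih₂ => exact ⟨fun hb => ih₁ hQ (h.1 hb), fun hb => ih₂ hQ (h.2 hb)⟩
  | regDiv => exact ⟨h.1, hQ _ h.2⟩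
  | loop => exact h
  | _ => exact hQ _ h

theorem Runs.of_wp {c : Program} {s : State} {Q : State → Prop} (h : wp c Q s) :
    Runs c s (cost c) Q := by
  induction c generalizing s Q with
  | skip => exact ⟨_, _, .skip s, le_rfl, h⟩
  | idxConst => exact ⟨_, _, .idxConst .., le_rfl, h⟩
  | idxAdd => exact ⟨_, _, .idxAdd .., le_rfl, h⟩
  | idxSub => exact ⟨_, _, .idxSub .., le_rfl, h⟩
  | regConst => exact ⟨_, _, .regConst .., le_rfl, h⟩
  | regAdd => exact ⟨_, _, .regAdd .., le_rfl, h⟩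
  | regSub => exact ⟨_, _, .regSub .., le_rfl, h⟩
  | regMul => exact ⟨_, _, .regMul .., le_rfl, h⟩
  | regDiv => exact ⟨_, _, .regDiv _ _ _ _ h.1, le_rfl, h.2⟩
  | load => exact ⟨_, _, .load .., le_rfl, h⟩
  | store => exact ⟨_, _, .store .., le_rfl, h⟩
  | seq c₁ c₂ ih₁ ih₂ => exact (ih₁ h).seq fun s hs => ih₂ hs
  | ite b c₁ c₂ ih₁ ih₂ =>
    by_cases hb : b.Holds s
    · obtain ⟨T, s', h1, h2, h3⟩ := ih₁ (h.1 hb)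
      exact ⟨_, _, .iteTrue hb h1, Nat.succ_le_succ (h2.trans (le_max_left _ _)), h3⟩
    · obtain ⟨T, s', h1, h2, h3⟩ := ih₂ (h.2 hb)
      exact ⟨_, _, .iteFalse hb h1, Nat.succ_le_succ (h2.trans (le_max_right _ _)), h3⟩
  | loop => exact h.elim

namespace State

variable (s : State) (d v a i r j : ℕ) (x : ℝ)

@[simp] theorem idx_setIdx : (s.setIdx d v).idx r = if r = d then v else s.idx r :=
  Function.update_apply _ _ _ _
@[simp] theorem reg_setIdx : (s.setIdx d v).reg = s.reg := rfl
@[simp] theorem mem_setIdx : (s.setIdx d v).mem = s.mem := rfl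
@[simp] theorem idx_setReg : (s.setReg d x).idx = s.idx := rfl
@[simp] theorem reg_setReg : (s.setReg d x).reg r = if r = d then x else s.reg r :=
  Function.update_apply _ _ _ _
@[simp] theorem mem_setReg : (s.setReg d x).mem = s.mem := rfl
@[simp] theorem idx_setMem : (s.setMem a i x).idx = s.idx := rfl
@[simp] theorem reg_setMem : (s.setMem a i x).reg = s.reg := rfl
@[simp] theorem mem_setMem (b : ℕ) :
    (s.setMem a i x).mem b = if b = a then Function.update (s.mem a) i x else s.mem b :=
  Function.update_apply _ _ _ _

end State

/-! ### The program

Use of the index registers: `0`, `1`, `2` hold `n`, `q`, `1`; `3`, `4`, `5` hold `m`, the number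
`2 * m + 3` of bins and the number `2 * m + 2` of the last bin; `6` is the row, `7` the column, `8`
the cell of the input tables, `9` a bin of the present ratio, `10` a bin of the next ratio, `11` an
address. Real registers: `0` holds `ε` and finally the output; `1`, `2`, `3` hold `0`, `1`, `2`;
`4` holds the lower bound `d`; `5` holds `2 * n` and then `e = ε / (2 * n)`; `6`, `7`, `8` hold
`e * d * (1 + e) ^ k`, `1 + e`, `(1 + e) ^ (-k)` while the breakpoints are computed; `10`, `11` hold
the vector to be distributed, `12`, `13` the present entries of the input tables; the others are
for intermediate results.
Arrays: `2` holds the ends of the cells of `[0, 1)`; `3`, `4` hold the moments and the masses of the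
bins of the present ratio, and `5`, `6` those of the next ratio. -/

/-- The sequential composition of a list of programs. -/
def block : List Program → Program
  | [] => .skip
  | [c] => c
  | c :: cs => .seq c (block cs)

/-- Adds the distance of the two entries in the current cell to the sum in register `11`. -/
def scanCell : Program :=
  block [.load 9 0 8, .load 10 1 8, .ite (.regLe 9 10) (.regSub 9 10 9) (.regSub 9 9 10),
    .regAdd 11 11 9, .idxAdd 8 8 2, .idxAdd 7 7 2]

/-- Updates the maximal distance of two rows in register `4` and adds `2` to register `5`. -/
def scanRow : Program :=
  .seq (block [.regConst 11 0, .idxConst 7 0])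
    (.seq (.loop (.idxLt 7 1) scanCell)
      (block [.regDiv 11 11 3, .ite (.regLt 4 11) (.regAdd 4 1 11) .skip, .regAdd 5 5 3,
        .idxAdd 6 6 2]))

/-- Computes the maximal distance of two rows and the number `2 * n` as a real number. -/
def scan : Program :=
  .seq (block [.idxConst 2 1, .regConst 2 1, .regConst 3 2]) (.loop (.idxLt 6 0) scanRow)

/-- Computes the next breakpoint. -/
def buildStep : Program :=
  block [.regMul 6 6 7, .regDiv 8 8 7, .idxAdd 3 3 2, .regSub 9 2 8, .store 2 3 9]

/-- Computes `m` and the breakpoints without logarithms, by repeated multiplication, and stores the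
trivial ratio. -/
def build : Program :=
  .seq (block [.regDiv 5 0 5, .regMul 6 5 4, .regAdd 7 2 5, .regConst 8 1,
      .ite (.regLt 1 6) .skip (.regConst 6 1)])
    (.seq (.loop (.regLt 6 2) buildStep)
      (block [.idxAdd 11 3 2, .store 2 11 2, .store 3 11 2, .store 4 11 2, .idxAdd 5 11 11,
        .idxAdd 4 5 2, .idxConst 6 0, .idxConst 8 0]))

/-- Adds the vector in the registers `10`, `11` to the current bin of the next ratio. -/
def deposit : Program :=
  block [.load 9 5 10, .regAdd 9 9 10, .store 5 10 9, .load 9 6 10, .regAdd 9 9 11, .store 6 10 9,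
    .load 9 5 5, .regSub 9 9 10, .store 5 5 9, .idxAdd 9 9 2]

/-- One step of the merging of the sorted bins of the present ratio, multiplied by an entry of the
next row, into the bins of the next ratio: either the bin of the present ratio is done, or the
pointer into the bins of the next ratio moves up. -/
def mergeStep : Program :=
  block [.load 14 3 9, .load 15 4 9, .regMul 10 14 12, .regMul 11 15 13,
    .ite (.regLt 1 11)
      (.ite (.idxLe 10 3)
        (block [.idxAdd 11 10 2, .load 9 2 11, .regMul 9 9 11,
          .ite (.regLe 9 10) (.idxAdd 10 10 2) deposit])
        (block [.idxSub 11 5 10, .load 9 2 11, .regMul 9 9 10,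
          .ite (.regLt 11 9) (.idxAdd 10 10 2) deposit]))
      (.idxAdd 9 9 2)]

/-- Processes one entry of the next row. -/
def column : Program :=
  .seq (block [.load 12 0 8, .load 13 1 8, .idxAdd 8 8 2, .idxAdd 7 7 2, .idxConst 9 0,
      .idxConst 10 0])
    (.loop (.idxLt 9 4) mergeStep)

/-- Moves one bin of the next ratio to the present ratio. -/
def copyStep : Program :=
  block [.load 9 5 9, .store 3 9 9, .load 9 6 9, .store 4 9 9, .store 5 9 1, .store 6 9 1,
    .idxAdd 9 9 2]

/-- Multiplies the sparsified ratio by the ratio of one row and sparsifies the product. -/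
def round : Program :=
  .seq (block [.store 5 5 2, .idxConst 7 0])
    (.seq (.loop (.idxLt 7 1) column)
      (.seq (.idxConst 9 0) (.seq (.loop (.idxLt 9 4) copyStep) (.idxAdd 6 6 2))))

/-- Adds the contribution of one bin to the output. -/
def totalStep : Program :=
  block [.load 14 3 9, .load 15 4 9,
    .ite (.regLt 14 15) (block [.regSub 15 15 14, .regAdd 0 0 15]) .skip, .idxAdd 9 9 2]

/-- Computes the output from the bins of the last ratio. -/
def total : Program :=
  .seq (block [.regConst 0 0, .idxConst 9 0]) (.loop (.idxLt 9 4) totalStep)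

/-- The program for the approximation algorithm. -/
def program : Program :=
  .seq scan (.seq build (.seq (.loop (.idxLt 6 0) round) total))

/-! ### Correctness of the program -/

/-- The registers and arrays that are never written after the first three steps. -/
structure Base (n q : ℕ) (A B : ℕ → ℝ) (s : State) : Prop where
  rows : s.idx 0 = n
  cols : s.idx 1 = q
  one : s.idx 2 = 1
  zeroReg : s.reg 1 = 0
  oneReg : s.reg 2 = 1
  fst : s.mem 0 = A
  snd : s.mem 1 = B

/-- The data that are fixed from the end of `build` on. -/
structure Tables (n q : ℕ) (A B : ℕ → ℝ) (e : ℝ) (m : ℕ) (s : State) : Prop where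
  base : Base n q A B s
  num : s.idx 3 = m
  bins : s.idx 4 = 2 * m + 3
  last : s.idx 5 = 2 * m + 2
  ends : ∀ t ≤ m + 1, s.mem 2 t = cutTo e m t

section

variable {n q : ℕ} {A B : ℕ → ℝ} {e : ℝ} {m : ℕ}

@[simp] theorem base_setIdx {s : State} {d v : ℕ} (hd : 3 ≤ d) :
    Base n q A B (s.setIdx d v) ↔ Base n q A B s := by
  have h0 : 0 ≠ d := by omega
  have h1 : 1 ≠ d := by omega
  have h2 : 2 ≠ d := by omega
  constructor <;> rintro ⟨a1, a2, a3, a4, a5, a6, a7⟩ <;> constructor <;> simp_all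

@[simp] theorem base_setReg {s : State} {d : ℕ} {v : ℝ} (hd : 3 ≤ d) :
    Base n q A B (s.setReg d v) ↔ Base n q A B s := by
  have h1 : 1 ≠ d := by omega
  have h2 : 2 ≠ d := by omega
  constructor <;> rintro ⟨a1, a2, a3, a4, a5, a6, a7⟩ <;> constructor <;> simp_all

@[simp] theorem base_setMem {s : State} {a i : ℕ} {v : ℝ} (ha : 2 ≤ a) :
    Base n q A B (s.setMem a i v) ↔ Base n q A B s := by
  have h0 : 0 ≠ a := by omega
  have h1 : 1 ≠ a := by omega
  constructor <;> rintro ⟨a1, a2, a3, a4, a5, a6, a7⟩ <;> constructor <;> simp_all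

@[simp] theorem base_setReg_zero {s : State} {v : ℝ} :
    Base n q A B (s.setReg 0 v) ↔ Base n q A B s := by
  constructor <;> rintro ⟨a1, a2, a3, a4, a5, a6, a7⟩ <;> constructor <;> simp_all

@[simp] theorem tables_setIdx {s : State} {d v : ℕ} (hd : 6 ≤ d) :
    Tables n q A B e m (s.setIdx d v) ↔ Tables n q A B e m s := by
  have h0 : 3 ≠ d := by omega
  have h1 : 4 ≠ d := by omega
  have h2 : 5 ≠ d := by omega
  have h3 : 3 ≤ d := by omega
  constructor <;> rintro ⟨a1, a2, a3, a4, a5⟩ <;> constructor <;> simp_all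

@[simp] theorem tables_setReg {s : State} {d : ℕ} {v : ℝ} (hd : 3 ≤ d) :
    Tables n q A B e m (s.setReg d v) ↔ Tables n q A B e m s := by
  constructor <;> rintro ⟨a1, a2, a3, a4, a5⟩ <;> constructor <;> simp_all

@[simp] theorem tables_setReg_zero {s : State} {v : ℝ} :
    Tables n q A B e m (s.setReg 0 v) ↔ Tables n q A B e m s := by
  constructor <;> rintro ⟨a1, a2, a3, a4, a5⟩ <;> constructor <;> simp_all

@[simp] theorem tables_setMem {s : State} {a i : ℕ} {v : ℝ} (ha : 3 ≤ a) :
    Tables n q A B e m (s.setMem a i v) ↔ Tables n q A B e m s := by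
  have h0 : 2 ≠ a := by omega
  have h1 : 2 ≤ a := by omega
  constructor <;> rintro ⟨a1, a2, a3, a4, a5⟩ <;> constructor <;> simp_all

end

section Merge

/-- The state of the merging when the bins below `b` are done and the pointer is at `c`. The bins
of the next ratio held the values `Y₀`, `p₀` when the merging began. -/
structure Merging (n q : ℕ) (A B : ℕ → ℝ) (e : ℝ) (m : ℕ) (Y p Y₀ p₀ : ℕ → ℝ) (x z : ℝ)
    (i j cell b c : ℕ) (s : State) : Prop where
  tables : Tables n q A B e m s
  row : s.idx 6 = i
  col : s.idx 7 = j
  cell : s.idx 8 = cell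
  src : s.idx 9 = b
  dst : s.idx 10 = c
  xReg : s.reg 12 = x
  zReg : s.reg 13 = z
  src_le : b ≤ 2 * m + 3
  dst_le : c ≤ 2 * m + 2
  moments : ∀ t < 2 * m + 3, s.mem 3 t = Y t
  masses : ∀ t < 2 * m + 3, s.mem 4 t = p t
  newMoments : ∀ t < 2 * m + 3,
    s.mem 5 t = Y₀ t + ∑ b' ∈ Finset.range b, momentPart e m Y p x z b' t
  newMasses : ∀ t < 2 * m + 3,
    s.mem 6 t = p₀ t + ∑ b' ∈ Finset.range b, massPart e m Y p x z b' t
  pointer : ∀ b' < 2 * m + 3, b ≤ b' → 0 < p b' * z → c ≤ bin e m (slope Y p x z b')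

variable {n q : ℕ} {A B : ℕ → ℝ} {e : ℝ} {m : ℕ} {Y p Y₀ p₀ : ℕ → ℝ} {x z : ℝ} {i j cell : ℕ}

theorem mul_slope {b : ℕ} (h : 0 < p b * z) : p b * z * slope Y p x z b = Y b * x := by
  have h1 := left_ne_zero_of_mul h.ne'
  have h2 := right_ne_zero_of_mul h.ne'
  rw [slope]
  field_simp

theorem slope_mono (hp : ∀ b, 0 ≤ p b) (hx : 0 ≤ x) (hz : 0 ≤ z)
    (hsort : ∀ b b', b < b' → Y b * p b' ≤ Y b' * p b) {b b' : ℕ} (hb : b ≤ b')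
    (h : 0 < p b * z) (h' : 0 < p b' * z) : slope Y p x z b ≤ slope Y p x z b' := by
  have h1 : 0 < p b := (hp b).lt_of_ne (left_ne_zero_of_mul h.ne').symm
  have h2 : 0 < p b' := (hp b').lt_of_ne (left_ne_zero_of_mul h'.ne').symm
  refine mul_le_mul_of_nonneg_right ?_ (div_nonneg hx hz)
  rcases hb.eq_or_lt with rfl | hlt
  · exact le_rfl
  · rw [div_le_div_iff₀ h1 h2]
    exact hsort b b' hlt

theorem beyond_slope_low {b c : ℕ} (hc : c ≤ m) (h : 0 < p b * z) :
    Beyond e m c (slope Y p x z b) ↔ cutTo e m (c + 1) * (p b * z) ≤ Y b * x := by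
  rw [Beyond, if_pos hc, ← mul_slope (x := x) h, mul_comm (p b * z) (slope _ _ _ _ _),
    mul_le_mul_iff_left₀ h]

theorem beyond_slope_high {b c : ℕ} (hc : ¬ c ≤ m) (h : 0 < p b * z) :
    Beyond e m c (slope Y p x z b) ↔ p b * z < cutTo e m (2 * m + 2 - c) * (Y b * x) := by
  rw [Beyond, if_neg hc, ← mul_slope (x := x) h, mul_left_comm]
  exact (lt_mul_iff_one_lt_right h).symm

theorem wp_deposit {b c : ℕ} {s : State} (h : Merging n q A B e m Y p Y₀ p₀ x z i j cell b c s)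
    (hb : b < 2 * m + 3) (hy : s.reg 10 = Y b * x) (hw : s.reg 11 = p b * z)
    (h0 : 0 < p b * z) (hbin : bin e m (slope Y p x z b) = c) :
    wp deposit (Merging n q A B e m Y p Y₀ p₀ x z i j cell (b + 1) c) s := by
  have hc : c < 2 * m + 3 := Nat.lt_succ_of_le h.dst_le
  have hl : 2 * m + 2 < 2 * m + 3 := Nat.lt_succ_self _
  simp only [deposit, block, wp]
  constructor
  · simpa using h.tables
  · simpa using h.row
  · simpa using h.col
  · simpa using h.cell
  · simp [h.src, h.tables.base.one]
  · simpa using h.dst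
  · simpa using h.xReg
  · simpa using h.zReg
  · exact hb
  · exact h.dst_le
  · simpa using h.moments
  · simpa using h.masses
  · intro t ht
    have h1 := h.newMoments t ht
    have h2 := h.newMoments c hc
    have h3 := h.newMoments _ hl
    simp [Function.update_apply, h.tables.last, h.dst, hy, hw, Finset.sum_range_succ]
    rw [momentPart, if_neg h0.ne', hbin]
    -- A vector added to the last bin is also subtracted from it: the bin starts from `1` and loses
    -- the moments of all finite points, of which only its own are put back.
    by_cases e1 : t = 2 * m + 2
    · subst e1
      by_cases e2 : c = 2 * m + 2
      · subst e2
        simp [h1]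
      · have e3 : ¬ 2 * m + 2 = c := fun h => e2 h.symm
        simp [e2, e3, h1]
        ring
    · by_cases e2 : t = c
      · subst e2
        simp [e1, h1]
        ring
      · have e3 : ¬ c = t := fun h => e2 h.symm
        simp [e1, e2, e3, h1]
  · intro t ht
    have h1 := h.newMasses t ht
    have h2 := h.newMasses c hc
    simp [Function.update_apply, h.tables.last, h.dst, hy, hw, Finset.sum_range_succ]
    rw [massPart, hbin]
    by_cases e2 : t = c
    · subst e2
      simp [h1]
      ring
    · have e3 : ¬ c = t := fun h => e2 h.symm
      simp [e2, e3, h1]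
  · intro b' hb' hbb' hw'
    exact h.pointer b' hb' (by omega) hw'

/-- The merging does not depend on the contents of the scratch registers. -/
theorem Merging.of_scratch {b c : ℕ} {s s' : State}
    (h : Merging n q A B e m Y p Y₀ p₀ x z i j cell b c s)
    (h1 : s'.idx = Function.update s.idx 11 (s'.idx 11)) (h2 : s'.mem = s.mem)
    (h3 : ∀ r < 4, s'.reg r = s.reg r) (h4 : s'.reg 12 = s.reg 12)
    (h5 : s'.reg 13 = s.reg 13) : Merging n q A B e m Y p Y₀ p₀ x z i j cell b c s' := by
  have hi : ∀ r, r ≠ 11 → s'.idx r = s.idx r := fun r hr => by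
    rw [h1, Function.update_of_ne hr]
  constructor
  · constructor
    · constructor
      · rw [hi _ (by norm_num)]; exact h.tables.base.rows
      · rw [hi _ (by norm_num)]; exact h.tables.base.cols
      · rw [hi _ (by norm_num)]; exact h.tables.base.one
      · rw [h3 _ (by norm_num)]; exact h.tables.base.zeroReg
      · rw [h3 _ (by norm_num)]; exact h.tables.base.oneReg
      · rw [h2]; exact h.tables.base.fst
      · rw [h2]; exact h.tables.base.snd
    · rw [hi _ (by norm_num)]; exact h.tables.num
    · rw [hi _ (by norm_num)]; exact h.tables.bins
    · rw [hi _ (by norm_num)]; exact h.tables.last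
    · rw [h2]; exact h.tables.ends
  · rw [hi _ (by norm_num)]; exact h.row
  · rw [hi _ (by norm_num)]; exact h.col
  · rw [hi _ (by norm_num)]; exact h.cell
  · rw [hi _ (by norm_num)]; exact h.src
  · rw [hi _ (by norm_num)]; exact h.dst
  · rw [h4]; exact h.xReg
  · rw [h5]; exact h.zReg
  · exact h.src_le
  · exact h.dst_le
  · rw [h2]; exact h.moments
  · rw [h2]; exact h.masses
  · rw [h2]; exact h.newMoments
  · rw [h2]; exact h.newMasses
  · exact h.pointer

/-- Every step of the merging increases `b + c`. If the pointer moves up, it does not pass the bin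
of any later vector, because the slopes increase with `b`. -/
theorem wp_mergeStep (he : 0 < e) (hp : ∀ b, 0 ≤ p b) (hY : ∀ b, 0 ≤ Y b) (hx : 0 ≤ x)
    (hz : 0 ≤ z) (hsort : ∀ b b', b < b' → Y b * p b' ≤ Y b' * p b) {b c : ℕ} {s : State}
    (h : Merging n q A B e m Y p Y₀ p₀ x z i j cell b c s) (hb : b < 2 * m + 3) :
    wp mergeStep (fun s' => ∃ b' c', b + c < b' + c' ∧
      Merging n q A B e m Y p Y₀ p₀ x z i j cell b' c' s') s := by
  have hadv : ∀ s', Merging n q A B e m Y p Y₀ p₀ x z i j cell b c s' → 0 < p b * z →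
      Beyond e m c (slope Y p x z b) →
      Merging n q A B e m Y p Y₀ p₀ x z i j cell b (c + 1) (s'.setIdx 10 (c + 1)) := by
    intro s' h' h0 hbey
    have hs : 0 ≤ slope Y p x z b :=
      mul_nonneg (div_nonneg (hY b) (hp b)) (div_nonneg hx hz)
    have hlt := (lt_bin_iff he hs).mpr hbey
    have hle := bin_le e m (slope Y p x z b)
    constructor
    · simpa using h'.tables
    · simpa using h'.row
    · simpa using h'.col
    · simpa using h'.cell
    · simpa using h'.src
    · simp
    · simpa using h'.xReg
    · simpa using h'.zReg
    · exact h'.src_le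
    · omega
    · simpa using h'.moments
    · simpa using h'.masses
    · simpa using h'.newMoments
    · simpa using h'.newMasses
    · intro b' hb' hbb' hw'
      exact Nat.succ_le_of_lt (hlt.trans_le
        (bin_mono he m (slope_mono hp hx hz hsort hbb' h0 hw')))
  have hbase := h.tables.base
  have hYb := h.moments b hb
  have hpb := h.masses b hb
  have hdst := h.dst_le
  simp [mergeStep, block, wp, Test.Holds, h.src, h.dst, hYb, hpb, h.xReg, h.zReg, hbase.zeroReg,
    hbase.one, h.tables.num, h.tables.last]
  have hscr : ∀ (v : ℕ) (u u' : ℝ), Merging n q A B e m Y p Y₀ p₀ x z i j cell b c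
      (((((((s.setReg 14 (Y b)).setReg 15 (p b)).setReg 10 (Y b * x)).setReg 11 (p b * z)).setIdx 11
        v).setReg 9 u).setReg 9 u') := by
    intro v u u'
    refine h.of_scratch ?_ rfl ?_ (by simp) (by simp)
    · funext r
      by_cases hr : r = 11 <;> simp [Function.update_apply, hr]
    · intro r hr
      interval_cases r <;> simp
  have hdep : ∀ (v : ℕ) (u u' : ℝ), 0 < p b * z → ¬ Beyond e m c (slope Y p x z b) →
      wp deposit (fun s' => ∃ b' c', b + c < b' + c' ∧
        Merging n q A B e m Y p Y₀ p₀ x z i j cell b' c' s')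
      (((((((s.setReg 14 (Y b)).setReg 15 (p b)).setReg 10 (Y b * x)).setReg 11 (p b * z)).setIdx 11
        v).setReg 9 u).setReg 9 u') := by
    intro v u u' h0 hbey
    have hs : 0 ≤ slope Y p x z b :=
      mul_nonneg (div_nonneg (hY b) (hp b)) (div_nonneg hx hz)
    have h1 := h.pointer b hb le_rfl h0
    rw [← lt_bin_iff he hs] at hbey
    refine wp_mono (fun s' hs' => ⟨b + 1, c, by omega, hs'⟩)
      (wp_deposit (hscr v u u') hb (by simp) (by simp) h0 (by omega))
  refine ⟨fun h0 => ⟨fun hc => ⟨fun ht => ?_, fun ht => ?_⟩,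
    fun hc => ⟨fun ht => ?_, fun ht => ?_⟩⟩, fun h0 => ?_⟩
  · rw [h.tables.ends _ (by omega), ← beyond_slope_low hc h0] at ht
    exact ⟨b, c + 1, by omega, hadv _ (hscr _ _ _) h0 ht⟩
  · rw [h.tables.ends _ (by omega), ← not_le, ← beyond_slope_low hc h0] at ht
    exact hdep _ _ _ h0 ht
  · rw [h.tables.ends _ (by omega), ← beyond_slope_high (not_le.mpr hc) h0] at ht
    exact ⟨b, c + 1, by omega, hadv _ (hscr _ _ _) h0 ht⟩
  · rw [h.tables.ends _ (by omega), ← not_lt, ← beyond_slope_high (not_le.mpr hc) h0] at ht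
    exact hdep _ _ _ h0 ht
  · have hw : p b * z = 0 := le_antisymm h0 (mul_nonneg (hp b) hz)
    refine ⟨b + 1, c, by omega, ?_⟩
    constructor
    · simpa using h.tables
    · simpa using h.row
    · simpa using h.col
    · simpa using h.cell
    · simp
    · simpa using h.dst
    · simpa using h.xReg
    · simpa using h.zReg
    · exact hb
    · exact h.dst_le
    · simpa using h.moments
    · simpa using h.masses
    · have e0 : ∀ t, momentPart e m Y p x z b t = 0 := fun t => if_pos hw
      simpa [Finset.sum_range_succ, e0] using h.newMoments
    · have e0 : ∀ t, massPart e m Y p x z b t = 0 := fun t => by rw [massPart, hw, ite_self]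
      simpa [Finset.sum_range_succ, e0] using h.newMasses
    · exact fun b' hb' hbb' hw' => h.pointer b' hb' (by omega) hw'

/-- The merging takes time proportional to the number of bins, since `b + c ≤ 4 * m + 5`. -/
theorem runs_merge (he : 0 < e) (hp : ∀ b, 0 ≤ p b) (hY : ∀ b, 0 ≤ Y b) (hx : 0 ≤ x)
    (hz : 0 ≤ z) (hsort : ∀ b b', b < b' → Y b * p b' ≤ Y b' * p b) {s : State}
    (h : Merging n q A B e m Y p Y₀ p₀ x z i j cell 0 0 s) :
    Runs (.loop (.idxLt 9 4) mergeStep) s (106 * (m + 1))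
      (fun s' => ∃ c, Merging n q A B e m Y p Y₀ p₀ x z i j cell (2 * m + 3) c s') := by
  have := Runs.loop (b := .idxLt 9 4) (c := mergeStep) (B := cost mergeStep) (s := s)
    (Inv := fun k s => ∃ b c, k + (b + c) = 4 * m + 5 ∧
      Merging n q A B e m Y p Y₀ p₀ x z i j cell b c s)
    (Q := fun s' => ∃ c, Merging n q A B e m Y p Y₀ p₀ x z i j cell (2 * m + 3) c s')
    (k := 4 * m + 5) ?_ ?_ ⟨0, 0, by omega, h⟩
  · refine this.mono ?_ fun _ h => h
    have : cost mergeStep = 20 := by decide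
    rw [this]
    omega
  · rintro k s ⟨b, c, hk, hI⟩ hb
    have hb' : b < 2 * m + 3 := by simpa [Test.Holds, hI.src, hI.tables.bins] using hb
    refine Runs.of_wp (wp_mono ?_ (wp_mergeStep he hp hY hx hz hsort hI hb'))
    rintro s' ⟨b', c', hlt, hI'⟩
    have h1 := hI'.src_le
    have h2 := hI'.dst_le
    exact ⟨4 * m + 5 - (b' + c'), by omega, b', c', by omega, hI'⟩
  · rintro k s ⟨b, c, hk, hI⟩ hb
    have hb' : 2 * m + 3 ≤ b := by simpa [Test.Holds, hI.src, hI.tables.bins] using hb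
    have := hI.src_le
    obtain rfl : b = 2 * m + 3 := by omega
    exact ⟨c, hI⟩

end Merge

section Round

variable {n q : ℕ} {A B : ℕ → ℝ} {e : ℝ} {m : ℕ}

/-- The state between two rounds, when `Y`, `p` are the moments and masses of the bins. -/
structure Between (n q : ℕ) (A B : ℕ → ℝ) (e : ℝ) (m : ℕ) (Y p : ℕ → ℝ) (i : ℕ) (s : State) :
    Prop where
  tables : Tables n q A B e m s
  row : s.idx 6 = i
  cell : s.idx 8 = i * q
  moments : ∀ t < 2 * m + 3, s.mem 3 t = Y t
  masses : ∀ t < 2 * m + 3, s.mem 4 t = p t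
  newMoments : ∀ t < 2 * m + 3, s.mem 5 t = 0
  newMasses : ∀ t < 2 * m + 3, s.mem 6 t = 0

/-- The moments of the next ratio after the first `j` entries of row `i`. -/
def partialMoment (q : ℕ) (A B : ℕ → ℝ) (e : ℝ) (m : ℕ) (Y p : ℕ → ℝ) (i j t : ℕ) : ℝ :=
  (if t = 2 * m + 2 then 1 else 0) + ∑ j' ∈ Finset.range j, ∑ b ∈ Finset.range (2 * m + 3),
    momentPart e m Y p (A (i * q + j')) (B (i * q + j')) b t

/-- The masses of the next ratio after the first `j` entries of row `i`. -/
def partialMass (q : ℕ) (A B : ℕ → ℝ) (e : ℝ) (m : ℕ) (Y p : ℕ → ℝ) (i j t : ℕ) : ℝ :=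
  ∑ j' ∈ Finset.range j, ∑ b ∈ Finset.range (2 * m + 3),
    massPart e m Y p (A (i * q + j')) (B (i * q + j')) b t

/-- The state during round `i`, when the first `j` entries of the row are done. -/
structure InRow (n q : ℕ) (A B : ℕ → ℝ) (e : ℝ) (m : ℕ) (Y p : ℕ → ℝ) (i j : ℕ) (s : State) :
    Prop where
  tables : Tables n q A B e m s
  row : s.idx 6 = i
  col : s.idx 7 = j
  col_le : j ≤ q
  cell : s.idx 8 = i * q + j
  moments : ∀ t < 2 * m + 3, s.mem 3 t = Y t
  masses : ∀ t < 2 * m + 3, s.mem 4 t = p t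
  newMoments : ∀ t < 2 * m + 3, s.mem 5 t = partialMoment q A B e m Y p i j t
  newMasses : ∀ t < 2 * m + 3, s.mem 6 t = partialMass q A B e m Y p i j t

/-- The state during the copying at the end of a round, when the bins below `b` are done. -/
structure Copying (n q : ℕ) (A B : ℕ → ℝ) (e : ℝ) (m : ℕ) (Y p : ℕ → ℝ) (i b : ℕ) (s : State) :
    Prop where
  tables : Tables n q A B e m s
  row : s.idx 6 = i
  cell : s.idx 8 = i * q + q
  src : s.idx 9 = b
  src_le : b ≤ 2 * m + 3
  moments : ∀ t < b, s.mem 3 t = Y t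
  masses : ∀ t < b, s.mem 4 t = p t
  newMoments : ∀ t < 2 * m + 3, s.mem 5 t = if t < b then 0 else Y t
  newMasses : ∀ t < 2 * m + 3, s.mem 6 t = if t < b then 0 else p t

variable {Y p : ℕ → ℝ}

theorem runs_column (he : 0 < e) (hp : ∀ b, 0 ≤ p b) (hY : ∀ b, 0 ≤ Y b)
    (hsort : ∀ b b', b < b' → Y b * p b' ≤ Y b' * p b) {i j : ℕ} (hA : 0 ≤ A (i * q + j))
    (hB : 0 ≤ B (i * q + j)) {s : State} (h : InRow n q A B e m Y p i j s) (hj : j < q) :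
    Runs column s (6 + 106 * (m + 1)) (InRow n q A B e m Y p i (j + 1)) := by
  have hbase := h.tables.base
  refine Runs.seq (Q₁ := Merging n q A B e m Y p (partialMoment q A B e m Y p i j)
    (partialMass q A B e m Y p i j) (A (i * q + j)) (B (i * q + j)) i (j + 1) (i * q + (j + 1)) 0 0)
    (Runs.of_wp ?_) fun s' h' => (runs_merge he hp hY hA hB hsort h').mono le_rfl ?_
  · simp only [block, wp]
    constructor
    · simpa using h.tables
    · simpa using h.row
    · simp [h.col, hbase.one]
    · simp [h.cell, hbase.one, add_assoc]
    · simp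
    · simp
    · simp [h.cell, hbase.fst]
    · simp [h.cell, hbase.snd]
    · omega
    · omega
    · simpa using h.moments
    · simpa using h.masses
    · simpa using h.newMoments
    · simpa using h.newMasses
    · exact fun _ _ _ _ => Nat.zero_le _
  · rintro s'' ⟨c, hc⟩
    constructor
    · exact hc.tables
    · exact hc.row
    · exact hc.col
    · exact hj
    · exact hc.cell
    · exact hc.moments
    · exact hc.masses
    · intro t ht
      rw [hc.newMoments t ht, partialMoment, partialMoment, Finset.sum_range_succ _ j, add_assoc]
    · intro t ht
      rw [hc.newMasses t ht, partialMass, partialMass, Finset.sum_range_succ _ j]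

theorem runs_copy {i : ℕ} {s : State} (h : Copying n q A B e m Y p i 0 s) :
    Runs (.loop (.idxLt 9 4) copyStep) s ((2 * m + 3) * 8 + 1)
      (Copying n q A B e m Y p i (2 * m + 3)) := by
  refine Runs.loop (Inv := fun k s => ∃ b, k + b = 2 * m + 3 ∧ Copying n q A B e m Y p i b s)
    (B := cost copyStep) ?_ ?_ ⟨0, rfl, h⟩
  · rintro k s ⟨b, hk, hI⟩ hb
    have hb' : b < 2 * m + 3 := by simpa [Test.Holds, hI.src, hI.tables.bins] using hb
    have hbase := hI.tables.base
    refine Runs.of_wp (wp_mono (fun s' hs' => ⟨k - 1, by omega, b + 1, by omega, hs'⟩)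
      (Q := Copying n q A B e m Y p i (b + 1)) ?_)
    simp only [copyStep, block, wp]
    have h1 := hI.newMoments b hb'
    have h2 := hI.newMasses b hb'
    rw [if_neg (lt_irrefl b)] at h1 h2
    constructor
    · simpa using hI.tables
    · simpa using hI.row
    · simpa using hI.cell
    · simp [hI.src, hbase.one]
    · exact hb'
    · intro t ht
      rcases (Nat.lt_succ_iff.mp ht).eq_or_lt with rfl | hlt
      · simp [hI.src, h1]
      · simp [hI.src, hI.moments t hlt, hlt.ne]
    · intro t ht
      rcases (Nat.lt_succ_iff.mp ht).eq_or_lt with rfl | hlt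
      · simp [hI.src, h2]
      · simp [hI.src, hI.masses t hlt, hlt.ne]
    · intro t ht
      have e1 : t < b + 1 ↔ t = b ∨ t < b := by omega
      by_cases e2 : t = b
      · subst e2
        simp [hI.src, hbase.zeroReg]
      · simp [hI.src, e1, e2, hI.newMoments t ht]
    · intro t ht
      have e1 : t < b + 1 ↔ t = b ∨ t < b := by omega
      by_cases e2 : t = b
      · subst e2
        simp [hI.src, hbase.zeroReg]
      · simp [hI.src, e1, e2, hI.newMasses t ht]
  · rintro k s ⟨b, hk, hI⟩ hb
    have hb' : 2 * m + 3 ≤ b := by simpa [Test.Holds, hI.src, hI.tables.bins] using hb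
    obtain rfl : b = 2 * m + 3 := le_antisymm hI.src_le hb'
    exact hI

theorem runs_round (he : 0 < e) (hp : ∀ b, 0 ≤ p b) (hY : ∀ b, 0 ≤ Y b)
    (hsort : ∀ b b', b < b' → Y b * p b' ≤ Y b' * p b) {i : ℕ}
    (hA : ∀ j < q, 0 ≤ A (i * q + j)) (hB : ∀ j < q, 0 ≤ B (i * q + j)) (hq : 0 < q) {s : State}
    (h : Between n q A B e m Y p i s) :
    Runs round s (150 * (q * (m + 1)))
      (Between n q A B e m (partialMoment q A B e m Y p i q) (partialMass q A B e m Y p i q)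
        (i + 1)) := by
  have hbase := h.tables.base
  have hmain : Runs round s (2 + (q * (6 + 106 * (m + 1) + 1) + 1 +
      (1 + ((2 * m + 3) * 8 + 1 + 1))))
      (Between n q A B e m (partialMoment q A B e m Y p i q) (partialMass q A B e m Y p i q)
        (i + 1)) := by
    refine Runs.seq (Q₁ := InRow n q A B e m Y p i 0) (Runs.of_wp ?_) fun s hs =>
      Runs.seq (Q₁ := InRow n q A B e m Y p i q) ?_ fun s hs =>
      Runs.seq (Q₁ := Copying n q A B e m (partialMoment q A B e m Y p i q)
        (partialMass q A B e m Y p i q) i 0) (Runs.of_wp ?_) fun s hs =>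
      Runs.seq (Q₁ := Copying n q A B e m (partialMoment q A B e m Y p i q)
        (partialMass q A B e m Y p i q) i (2 * m + 3)) (runs_copy hs) fun s hs => Runs.of_wp ?_
    · simp only [block, wp]
      constructor
      · simpa using h.tables
      · simpa using h.row
      · simp
      · omega
      · simpa using h.cell
      · simpa using h.moments
      · simpa using h.masses
      · intro t ht
        by_cases e1 : t = 2 * m + 2
        · simp [partialMoment, h.tables.last, hbase.oneReg, e1]
        · simp [partialMoment, h.tables.last, e1, h.newMoments t ht]
      · intro t ht
        simp [partialMass, h.newMasses t ht]
    · refine Runs.loop (Inv := fun k s => ∃ j, k + j = q ∧ InRow n q A B e m Y p i j s) ?_ ?_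
        ⟨0, rfl, hs⟩
      · rintro k s ⟨j, hk, hI⟩ hj
        have hj' : j < q := by simpa [Test.Holds, hI.col, hI.tables.base.cols] using hj
        exact (runs_column he hp hY hsort (hA j hj') (hB j hj') hI hj').mono le_rfl
          fun s' hs' => ⟨k - 1, by omega, j + 1, by omega, hs'⟩
      · rintro k s ⟨j, hk, hI⟩ hj
        have hj' : q ≤ j := by simpa [Test.Holds, hI.col, hI.tables.base.cols] using hj
        obtain rfl : j = q := le_antisymm hI.col_le hj'
        exact hI
    · simp only [wp]
      constructor
      · simpa using hs.tables
      · simpa using hs.row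
      · simpa using hs.cell
      · simp
      · omega
      · simp
      · simp
      · simpa using hs.newMoments
      · simpa using hs.newMasses
    · simp only [wp]
      constructor
      · simpa using hs.tables
      · simp [hs.row, hs.tables.base.one]
      · simp [hs.cell, Nat.succ_mul]
      · simpa using hs.moments
      · simpa using hs.masses
      · intro t ht
        simp [hs.newMoments t ht, ht]
      · intro t ht
        simp [hs.newMasses t ht, ht]
  refine hmain.mono ?_ fun _ h => h
  have h1 : m + 1 ≤ q * (m + 1) := Nat.le_mul_of_pos_left _ hq
  have h2 : q ≤ q * (m + 1) := Nat.le_mul_of_pos_right _ (Nat.succ_pos m)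
  have h3 : q * (6 + 106 * (m + 1) + 1) = 7 * q + 106 * (q * (m + 1)) := by ring
  rw [h3]
  omega

theorem runs_total {i : ℕ} {s : State} (h : Between n q A B e m Y p i s) :
    Runs total s (2 + ((2 * m + 3) * 7 + 1))
      (fun s' => s'.output = ∑ c ∈ Finset.range (2 * m + 3), max (p c - Y c) 0) := by
  let Inv : ℕ → State → Prop := fun b s => Tables n q A B e m s ∧ s.idx 9 = b ∧ b ≤ 2 * m + 3 ∧
    (∀ t < 2 * m + 3, s.mem 3 t = Y t) ∧ (∀ t < 2 * m + 3, s.mem 4 t = p t) ∧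
    s.reg 0 = ∑ c ∈ Finset.range b, max (p c - Y c) 0
  refine Runs.seq (Q₁ := Inv 0) (Runs.of_wp ?_) fun s hs =>
    Runs.loop (Inv := fun k s => ∃ b, k + b = 2 * m + 3 ∧ Inv b s) (B := cost totalStep) ?_ ?_
      ⟨0, rfl, hs⟩
  · simp only [block, wp]
    exact ⟨by simpa using h.tables, by simp, by omega, by simpa using h.moments,
      by simpa using h.masses, by simp⟩
  · rintro k s ⟨b, hk, h1, h2, h3, h4, h5, h6⟩ hb
    have hb' : b < 2 * m + 3 := by simpa [Test.Holds, h2, h1.bins] using hb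
    refine Runs.of_wp (wp_mono (fun s' hs' => ⟨k - 1, by omega, b + 1, by omega, hs'⟩)
      (Q := Inv (b + 1)) ?_)
    have h7 := h4 b hb'
    have h8 := h5 b hb'
    simp only [totalStep, block, wp]
    refine ⟨fun ht => ?_, fun ht => ?_⟩
    · have ht' : Y b < p b := by simpa [Test.Holds, h2, h7, h8] using ht
      exact ⟨by simpa using h1, by simp [h2, h1.base.one], hb', by simpa using h4,
        by simpa using h5,
        by simp [h2, h7, h8, h6, Finset.sum_range_succ, ht'.le]⟩
    · have ht' : p b ≤ Y b := by simpa [Test.Holds, h2, h7, h8] using ht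
      exact ⟨by simpa using h1, by simp [h2, h1.base.one], hb', by simpa using h4,
        by simpa using h5,
        by simp [h6, Finset.sum_range_succ, ht']⟩
  · rintro k s ⟨b, hk, h1, h2, h3, h4, h5, h6⟩ hb
    have hb' : 2 * m + 3 ≤ b := by simpa [Test.Holds, h2, h1.bins] using hb
    obtain rfl : b = 2 * m + 3 := le_antisymm h3 hb'
    exact h6

end Round

/-! ### The first two phases -/

section Scan

variable {n q : ℕ} {A B : ℕ → ℝ} {ε : ℝ}

/-- The facts that hold throughout the first phase. -/
structure Scanning (n q : ℕ) (A B : ℕ → ℝ) (ε : ℝ) (s : State) : Prop where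
  base : Base n q A B s
  num : s.idx 3 = 0
  eps : s.reg 0 = ε
  two : s.reg 3 = 2
  rest : ∀ a c, 2 ≤ a → s.mem a c = 0

@[simp] theorem scanning_setIdx {s : State} {d v : ℕ} (hd : 4 ≤ d) :
    Scanning n q A B ε (s.setIdx d v) ↔ Scanning n q A B ε s := by
  have h0 : 3 ≠ d := by omega
  have h1 : 3 ≤ d := by omega
  constructor <;> rintro ⟨a1, a2, a3, a4, a5⟩ <;> constructor <;> simp_all

@[simp] theorem scanning_setReg {s : State} {d : ℕ} {v : ℝ} (hd : 4 ≤ d) :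
    Scanning n q A B ε (s.setReg d v) ↔ Scanning n q A B ε s := by
  have h0 : 3 ≠ d := by omega
  have h1 : 3 ≤ d := by omega
  have h2 : 0 ≠ d := by omega
  constructor <;> rintro ⟨a1, a2, a3, a4, a5⟩ <;> constructor <;> simp_all

/-- The total variation distance of the rows with number `i` of two tables. -/
def rowDist (q : ℕ) (A B : ℕ → ℝ) (i : ℕ) : ℝ :=
  (∑ j ∈ Finset.range q, |A (i * q + j) - B (i * q + j)|) / 2

/-- The number `d` is the maximum of `0` and of the first `i` values of `f`. -/
def IsMaxBelow (f : ℕ → ℝ) (i : ℕ) (d : ℝ) : Prop :=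
  (∀ i' < i, f i' ≤ d) ∧ 0 ≤ d ∧ (d = 0 ∨ ∃ i' < i, d = f i')

theorem IsMaxBelow.succ {f : ℕ → ℝ} {i : ℕ} {d : ℝ} (h : IsMaxBelow f i d) :
    IsMaxBelow f (i + 1) (if d < f i then f i else d) := by
  obtain ⟨h1, h2, h3⟩ := h
  split_ifs with hd
  · refine ⟨fun i' hi' => ?_, by linarith, .inr ⟨i, by omega, rfl⟩⟩
    rcases (Nat.lt_succ_iff.mp hi').eq_or_lt with rfl | hlt
    · exact le_rfl
    · exact (h1 i' hlt).trans hd.le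
  · refine ⟨fun i' hi' => ?_, h2, h3.imp_right fun ⟨i', hi', h⟩ => ⟨i', by omega, h⟩⟩
    rcases (Nat.lt_succ_iff.mp hi').eq_or_lt with rfl | hlt
    · exact not_lt.mp hd
    · exact h1 i' hlt

/-- The state of the first phase between two rows. -/
structure ScanRows (n q : ℕ) (A B : ℕ → ℝ) (ε : ℝ) (i : ℕ) (s : State) : Prop where
  scanning : Scanning n q A B ε s
  row : s.idx 6 = i
  row_le : i ≤ n
  cell : s.idx 8 = i * q
  max : IsMaxBelow (rowDist q A B) i (s.reg 4)
  count : s.reg 5 = 2 * i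

/-- The state of the first phase within a row. -/
structure ScanCells (n q : ℕ) (A B : ℕ → ℝ) (ε : ℝ) (i j : ℕ) (s : State) : Prop where
  scanning : Scanning n q A B ε s
  row : s.idx 6 = i
  row_lt : i < n
  col : s.idx 7 = j
  col_le : j ≤ q
  cell : s.idx 8 = i * q + j
  max : IsMaxBelow (rowDist q A B) i (s.reg 4)
  count : s.reg 5 = 2 * i
  sum : s.reg 11 = ∑ j' ∈ Finset.range j, |A (i * q + j') - B (i * q + j')|

theorem runs_scanCells {i : ℕ} {s : State} (h : ScanCells n q A B ε i 0 s) :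
    Runs (.loop (.idxLt 7 1) scanCell) s (q * 8 + 1) (ScanCells n q A B ε i q) := by
  refine Runs.loop (Inv := fun k s => ∃ j, k + j = q ∧ ScanCells n q A B ε i j s)
    (B := cost scanCell) ?_ ?_ ⟨0, rfl, h⟩
  · rintro k s ⟨j, hk, hI⟩ hj
    have hbase := hI.scanning.base
    have hj' : j < q := by simpa [Test.Holds, hI.col, hbase.cols] using hj
    refine Runs.of_wp (wp_mono (fun s' hs' => ⟨k - 1, by omega, j + 1, by omega, hs'⟩)
      (Q := ScanCells n q A B ε i (j + 1)) ?_)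
    simp only [scanCell, block, wp]
    refine ⟨fun ht => ?_, fun ht => ?_⟩
    · have ht' : A (i * q + j) ≤ B (i * q + j) := by
        simpa [Test.Holds, hI.cell, hbase.fst, hbase.snd] using ht
      constructor
      · simpa using hI.scanning
      · simpa using hI.row
      · exact hI.row_lt
      · simp [hI.col, hbase.one]
      · exact hj'
      · simp [hI.cell, hbase.one, add_assoc]
      · simpa using hI.max
      · simpa using hI.count
      · simp [hI.cell, hbase.fst, hbase.snd, Finset.sum_range_succ, hI.sum,
          abs_of_nonpos (sub_nonpos.mpr ht')]
    · have ht' : B (i * q + j) < A (i * q + j) := by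
        simpa [Test.Holds, hI.cell, hbase.fst, hbase.snd] using ht
      constructor
      · simpa using hI.scanning
      · simpa using hI.row
      · exact hI.row_lt
      · simp [hI.col, hbase.one]
      · exact hj'
      · simp [hI.cell, hbase.one, add_assoc]
      · simpa using hI.max
      · simpa using hI.count
      · simp [hI.cell, hbase.fst, hbase.snd, Finset.sum_range_succ, hI.sum,
          abs_of_pos (sub_pos.mpr ht')]
  · rintro k s ⟨j, hk, hI⟩ hj
    have hj' : q ≤ j := by simpa [Test.Holds, hI.col, hI.scanning.base.cols] using hj
    obtain rfl : j = q := le_antisymm hI.col_le hj'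
    exact hI

theorem runs_scanRow {i : ℕ} {s : State} (h : ScanRows n q A B ε i s) (hi : i < n) :
    Runs scanRow s (2 + (q * 8 + 1 + 5)) (ScanRows n q A B ε (i + 1)) := by
  refine Runs.seq (Q₁ := ScanCells n q A B ε i 0) (Runs.of_wp ?_) fun s hs =>
    Runs.seq (runs_scanCells hs) fun s hs => Runs.of_wp ?_
  · simp only [block, wp]
    constructor
    · simpa using h.scanning
    · simpa using h.row
    · exact hi
    · simp
    · omega
    · simpa using h.cell
    · simpa using h.max
    · simpa using h.count
    · simp
  · have hbase := hs.scanning.base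
    have hmax := hs.max.succ
    simp only [block, wp]
    refine ⟨by simp [hs.scanning.two], fun ht => ?_, fun ht => ?_⟩
    · have ht' : s.reg 4 < rowDist q A B i := by
        simpa [Test.Holds, hs.scanning.two, hs.sum, rowDist] using ht
      rw [if_pos ht'] at hmax
      constructor
      · simpa using hs.scanning
      · simp [hs.row, hbase.one]
      · exact hi
      · simp [hs.cell, Nat.succ_mul]
      · simpa [hbase.zeroReg, hs.sum, hs.scanning.two, rowDist] using hmax
      · simp [hs.count, hs.scanning.two]
        ring
    · have ht' : ¬ s.reg 4 < rowDist q A B i := by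
        simpa [Test.Holds, hs.scanning.two, hs.sum, rowDist] using ht
      rw [if_neg ht'] at hmax
      constructor
      · simpa using hs.scanning
      · simp [hs.row, hbase.one]
      · exact hi
      · simp [hs.cell, Nat.succ_mul]
      · simpa using hmax
      · simp [hs.count, hs.scanning.two]
        ring

theorem runs_scan {s : State} (h0 : s.idx 0 = n) (h1 : s.idx 1 = q)
    (hidx : ∀ r, 2 ≤ r → s.idx r = 0) (heps : s.reg 0 = ε) (hreg : ∀ r, 1 ≤ r → s.reg r = 0)
    (hA : s.mem 0 = A) (hB : s.mem 1 = B) (hmem : ∀ a c, 2 ≤ a → s.mem a c = 0) :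
    Runs scan s (3 + (n * (2 + (q * 8 + 1 + 5) + 1) + 1)) (ScanRows n q A B ε n) := by
  refine Runs.seq (Q₁ := ScanRows n q A B ε 0) (Runs.of_wp ?_) fun s hs => ?_
  · simp only [block, wp]
    constructor
    · constructor
      · constructor <;> simp [h0, h1, hA, hB, hreg]
      · simp [hidx]
      · simp [heps]
      · simp
      · simpa using hmem
    · simp [hidx]
    · omega
    · simp [hidx]
    · simp [IsMaxBelow, hreg]
    · simp [hreg]
  · refine Runs.loop (Inv := fun k s => ∃ i, k + i = n ∧ ScanRows n q A B ε i s) ?_ ?_ ⟨0, rfl, hs⟩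
    · rintro k s ⟨i, hk, hI⟩ hi
      have hi' : i < n := by simpa [Test.Holds, hI.row, hI.scanning.base.rows] using hi
      exact (runs_scanRow hI hi').mono le_rfl fun s' hs' => ⟨k - 1, by omega, i + 1, by omega, hs'⟩
    · rintro k s ⟨i, hk, hI⟩ hi
      have hi' : n ≤ i := by simpa [Test.Holds, hI.row, hI.scanning.base.rows] using hi
      obtain rfl : i = n := le_antisymm hI.row_le hi'
      exact hI

end Scan

section Build

variable {n q : ℕ} {A B : ℕ → ℝ} {ε e δ : ℝ}

/-- The state of the second phase after `k` breakpoints. For `δ = 0` register `6` starts from `1`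
instead of `δ`, so that the loop stops at once. -/
structure Building (n q : ℕ) (A B : ℕ → ℝ) (e δ : ℝ) (k : ℕ) (s : State) : Prop where
  base : Base n q A B s
  num : s.idx 3 = k
  num_le : k ≤ numIntervals e δ
  growth : s.reg 6 = (if 0 < δ then δ else 1) * (1 + e) ^ k
  factor : s.reg 7 = 1 + e
  decay : s.reg 8 = ((1 + e) ^ k)⁻¹
  ends : ∀ t ≤ k, s.mem 2 t = cut e t
  rest : ∀ a c, 3 ≤ a → s.mem a c = 0

theorem numIntervals_zero (e : ℝ) : numIntervals e 0 = 0 := by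
  simp [numIntervals]

theorem runs_buildLoop (he : 0 < e) (hδ : 0 ≤ δ) {s : State} (h : Building n q A B e δ 0 s) :
    Runs (.loop (.regLt 6 2) buildStep) s (numIntervals e δ * 6 + 1)
      (Building n q A B e δ (numIntervals e δ)) := by
  have htest : ∀ k s, Building n q A B e δ k s →
      ((Test.regLt 6 2).Holds s ↔ k < numIntervals e δ) := by
    intro k s hI
    simp only [Test.Holds, hI.growth, hI.base.oneReg]
    rcases hδ.eq_or_lt with rfl | h
    · have : (1 : ℝ) ≤ (1 + e) ^ k := one_le_pow₀ (by linarith)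
      simp [numIntervals_zero, this]
    · rw [if_pos h, lt_numIntervals_iff he h]
  refine Runs.loop (Inv := fun l s => ∃ k, l + k = numIntervals e δ ∧ Building n q A B e δ k s)
    (B := cost buildStep) ?_ ?_ ⟨0, rfl, h⟩
  · rintro l s ⟨k, hl, hI⟩ hk
    have hk' := (htest k s hI).mp hk
    refine Runs.of_wp (wp_mono (fun s' hs' => ⟨l - 1, by omega, k + 1, by omega, hs'⟩)
      (Q := Building n q A B e δ (k + 1)) ?_)
    have hbase := hI.base
    have h1e : (1 + e) ≠ 0 := by positivity
    simp only [buildStep, block, wp]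
    refine ⟨by simpa [hI.factor] using h1e, ?_⟩
    constructor
    · simpa using hbase
    · simp [hI.num, hbase.one]
    · exact hk'
    · simp [hI.growth, hI.factor, pow_succ, mul_assoc]
    · simpa using hI.factor
    · simp [hI.decay, hI.factor, pow_succ, div_eq_mul_inv, mul_comm]
    · intro t ht
      rcases ht.eq_or_lt with rfl | hlt
      · simp [hI.num, hbase.one, hI.decay, hI.factor, hbase.oneReg, cut, pow_succ, div_eq_mul_inv,
          mul_comm]
      · simp [hI.num, hbase.one, hlt.ne, hI.ends t (by omega)]
    · intro a c ha
      have : a ≠ 2 := by omega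
      simp [this, hI.rest a c ha]
  · rintro l s ⟨k, hl, hI⟩ hk
    have hk' := (htest k s hI).not.mp hk
    obtain rfl : k = numIntervals e δ := by omega
    exact hI

theorem runs_build (hn : 0 < n) (hε : 0 < ε) {d : ℝ} (hd : 0 ≤ d) (he : e = ε / (2 * n))
    {m : ℕ} (hm : m = numIntervals e (e * d)) {s : State} (h : ScanRows n q A B ε n s)
    (hsd : s.reg 4 = d) :
    Runs build s (6 + (m * 6 + 1 + 8)) (Between n q A B e m (fun c => if c = m + 1 then 1 else 0)
      (fun c => if c = m + 1 then 1 else 0) 0) := by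
  have hnR : (0 : ℝ) < n := by exact_mod_cast hn
  have he0 : 0 < e := by rw [he]; positivity
  have hbase := h.scanning.base
  refine Runs.seq (Q₁ := Building n q A B e (e * d) 0) (Runs.of_wp ?_) fun s hs =>
    Runs.seq (Q₁ := Building n q A B e (e * d) m) (hm ▸ runs_buildLoop he0 (by positivity) hs)
      fun s hs => Runs.of_wp ?_
  · have h2 : (2 * (n : ℝ)) ≠ 0 := by positivity
    have hmem : ∀ c, s.mem 2 c = 0 := fun c => h.scanning.rest 2 c le_rfl
    simp only [block, wp]
    refine ⟨by simpa [h.count] using hn.ne', fun ht => ?_, fun ht => ?_⟩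
    · have ht' : 0 < e * d := by
        simpa [Test.Holds, hbase.zeroReg, h.count, h.scanning.eps, hsd, ← he] using ht
      constructor
      · simpa using hbase
      · simpa using h.scanning.num
      · omega
      · simp [h.count, h.scanning.eps, hsd, ← he, ht']
      · simp [h.count, h.scanning.eps, ← he, hbase.oneReg]
      · simp
      · simp [hmem, cut_zero]
      · intro a c ha
        simpa using h.scanning.rest a c (by omega)
    · have ht' : ¬ 0 < e * d := by
        simpa [Test.Holds, hbase.zeroReg, h.count, h.scanning.eps, hsd, ← he] using ht
      constructor
      · simpa using hbase
      · simpa using h.scanning.num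
      · omega
      · rw [if_neg ht']
        simp
      · simp [h.count, h.scanning.eps, ← he, hbase.oneReg]
      · simp
      · simp [hmem, cut_zero]
      · intro a c ha
        simpa using h.scanning.rest a c (by omega)
  · have hb := hs.base
    simp only [block, wp]
    constructor
    · constructor
      · simpa using hb
      · simpa using hs.num
      · simp [hs.num, hb.one]
        omega
      · simp [hs.num, hb.one]
        omega
      · intro t ht
        rcases ht.eq_or_lt with rfl | hlt
        · simp [hs.num, hb.one, hb.oneReg, cutTo]
        · have : t ≤ m := by omega
          simp [hs.num, hb.one, hlt.ne, hs.ends t this, cutTo, this]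
    · simp
    · simp
    · intro t _
      simp [hs.num, hb.one, hb.oneReg, Function.update_apply, hs.rest]
    · intro t _
      simp [hs.num, hb.one, hb.oneReg, Function.update_apply, hs.rest]
    · intro t _
      simp [hs.rest]
    · intro t _
      simp [hs.rest]

end Build

/-! ### The program computes the output of the algorithm -/

theorem rowMajor_apply {n q : ℕ} (M : Fin n → Fin q → ℝ) (i : Fin n) (j : Fin q) :
    rowMajor M (i * q + j) = M i j := by
  have e : (i : ℕ) * q + j = (finProdFinEquiv (i, j) : Fin (n * q)) := by
    simp [finProdFinEquiv, mul_comm, add_comm]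
  rw [e, rowMajor, dif_pos (finProdFinEquiv (i, j)).2]
  simp only [Fin.eta, Equiv.symm_apply_apply]

theorem rowMajor_extendRows {n q : ℕ} (hn : 0 < n) (M : Fin n → Fin q → ℝ) {i : ℕ} (hi : i < n)
    (j : Fin q) : rowMajor M (i * q + j) = extendRows hn M i j := by
  rw [extendRows_of_lt hn M hi]
  exact rowMajor_apply M ⟨i, hi⟩ j

theorem rowDist_rowMajor {n q : ℕ} (P Q : Fin n → Fin q → ℝ) (i : Fin n) :
    rowDist q (rowMajor P) (rowMajor Q) i = tvDist (P i) (Q i) := by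
  rw [rowDist, Finset.sum_range, tvDist]
  simp only [rowMajor_apply]
  ring

theorem eq_lowerBound {n q : ℕ} (hn : 0 < n) {P Q : Fin n → Fin q → ℝ} {d : ℝ}
    (h : IsMaxBelow (rowDist q (rowMajor P) (rowMajor Q)) n d) : d = lowerBound P Q := by
  have : Nonempty (Fin n) := ⟨⟨0, hn⟩⟩
  obtain ⟨h1, h2, h3⟩ := h
  refine le_antisymm ?_ (ciSup_le fun i => ?_)
  · rcases h3 with rfl | ⟨i, hi, rfl⟩
    · exact lowerBound_nonneg P Q
    · refine le_trans (rowDist_rowMajor P Q ⟨i, hi⟩).le ?_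
      exact le_ciSup (f := fun i => tvDist (P i) (Q i)) (Set.finite_range _).bddAbove _
  · rw [← rowDist_rowMajor]
    exact h1 i i.2

theorem runs_rounds {n q : ℕ} (hn : 0 < n) (hq : 0 < q) {P Q : Fin n → Fin q → ℝ}
    (hP : ∀ i, P i ∈ stdSimplex ℝ (Fin q)) (hQ : ∀ i, Q i ∈ stdSimplex ℝ (Fin q)) {e : ℝ}
    (he : 0 < e) {m : ℕ} {s : State} {R : ℕ → ℝ →₀ ℝ}
    (hR : R = roundRatio e m (extendRows hn P) (extendRows hn Q))
    (h : Between n q (rowMajor P) (rowMajor Q) e m (binMoment e m (R 0)) (binMass e m (R 0)) 0 s) :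
    Runs (.loop (.idxLt 6 0) round) s (n * (150 * (q * (m + 1)) + 1) + 1)
      (Between n q (rowMajor P) (rowMajor Q) e m (binMoment e m (R n)) (binMass e m (R n)) n) := by
  refine Runs.loop (Inv := fun k s => ∃ i, k + i = n ∧
    Between n q (rowMajor P) (rowMajor Q) e m (binMoment e m (R i)) (binMass e m (R i)) i s) ?_ ?_
    ⟨0, rfl, h⟩
  · rintro k s ⟨i, hk, hI⟩ hi
    have hi' : i < n := by simpa [Test.Holds, hI.row, hI.tables.base.rows] using hi
    have hRi : IsRatio (R i) := by
      rw [hR]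
      exact isRatio_roundRatio e m (fun i => hP _) (fun i => hQ _) i
    have hA : ∀ j < q, 0 ≤ rowMajor P (i * q + j) := fun j hj =>
      (rowMajor_apply P ⟨i, hi'⟩ ⟨j, hj⟩).symm ▸ (hP _).1 _
    have hB : ∀ j < q, 0 ≤ rowMajor Q (i * q + j) := fun j hj =>
      (rowMajor_apply Q ⟨i, hi'⟩ ⟨j, hj⟩).symm ▸ (hQ _).1 _
    refine (runs_round he (binMass_nonneg e m hRi) (binMoment_nonneg e m hRi)
      (fun b b' hbb => bins_sorted he m hRi hbb) hA hB hq hI).mono le_rfl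
      fun s' hs' => ⟨k - 1, by omega, i + 1, by omega, ?_⟩
    have hsucc : R (i + 1) = mulIndep (binRatio m (binMoment e m (R i)) (binMass e m (R i)))
        (ratioFin (extendRows hn P i) (extendRows hn Q i)) := by
      rw [hR, roundRatio]
    have e1 : binMoment e m (R (i + 1)) =
        partialMoment q (rowMajor P) (rowMajor Q) e m (binMoment e m (R i)) (binMass e m (R i))
          i q := by
      funext c
      rw [hsucc, binMoment_mulIndep, partialMoment, Finset.sum_range]
      simp only [rowMajor_extendRows hn _ hi']
    have e2 : binMass e m (R (i + 1)) =
        partialMass q (rowMajor P) (rowMajor Q) e m (binMoment e m (R i)) (binMass e m (R i))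
          i q := by
      funext c
      rw [hsucc, binMass_mulIndep, partialMass, Finset.sum_range]
      simp only [rowMajor_extendRows hn _ hi']
    rwa [e1, e2]
  · rintro k s ⟨i, hk, hI⟩ hi
    have hi' : n ≤ i := by simpa [Test.Holds, hI.row, hI.tables.base.rows] using hi
    obtain rfl : i = n := by omega
    exact hI

/-- The program computes the output of the algorithm in time proportional to the size of the input
and to the number of bins. -/
theorem runs_program {n q : ℕ} (hn : 0 < n) (hq : 0 < q) {P Q : Fin n → Fin q → ℝ}
    (hP : ∀ i, P i ∈ stdSimplex ℝ (Fin q)) (hQ : ∀ i, Q i ∈ stdSimplex ℝ (Fin q)) {ε : ℝ}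
    (hε : 0 < ε) :
    Runs program (inputState P Q ε)
      (250 * (n * q * (numIntervals (ε / (2 * n)) (ε / (2 * n) * lowerBound P Q) + 1)))
      (fun s => s.output = algorithmOutput hn P Q ε) := by
  have hnR : (0 : ℝ) < n := by exact_mod_cast hn
  obtain ⟨e, he⟩ : ∃ e, e = ε / (2 * n) := ⟨_, rfl⟩
  have he0 : 0 < e := by rw [he]; positivity
  obtain ⟨m, hm⟩ : ∃ m, m = numIntervals e (e * lowerBound P Q) := ⟨_, rfl⟩
  obtain ⟨R, hR⟩ : ∃ R, R = roundRatio e m (extendRows hn P) (extendRows hn Q) := ⟨_, rfl⟩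
  rw [← he, ← hm]
  have hmain : Runs program (inputState P Q ε)
      ((3 + (n * (2 + (q * 8 + 1 + 5) + 1) + 1)) + ((6 + (m * 6 + 1 + 8)) +
        ((n * (150 * (q * (m + 1)) + 1) + 1) + (2 + ((2 * m + 3) * 7 + 1)))))
      (fun s => s.output = algorithmOutput hn P Q ε) := by
    refine Runs.seq (Q₁ := ScanRows n q (rowMajor P) (rowMajor Q) ε n) (runs_scan rfl rfl ?_ rfl ?_
      rfl rfl ?_) fun s hs => ?_
    · intro r hr
      have h0 : r ≠ 0 := by omega
      have h1 : r ≠ 1 := by omega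
      simp [inputState, h0, h1]
    · intro r hr
      have h0 : r ≠ 0 := by omega
      simp [inputState, h0]
    · intro a c ha
      have h0 : a ≠ 0 := by omega
      have h1 : a ≠ 1 := by omega
      simp [inputState, h0, h1]
    have hd := eq_lowerBound hn hs.max
    refine Runs.seq (runs_build hn hε (lowerBound_nonneg P Q) he hm hs hd) fun s hs => ?_
    have e1 : (fun c => if c = m + 1 then 1 else 0) = binMoment e m (R 0) := by
      funext c
      rw [hR, roundRatio, binMoment_single_one he0]
    have e2 : (fun c => if c = m + 1 then 1 else 0) = binMass e m (R 0) := by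
      funext c
      rw [hR, roundRatio, binMass_single_one he0]
    have hs' : Between n q (rowMajor P) (rowMajor Q) e m (binMoment e m (R 0))
        (binMass e m (R 0)) 0 s := by
      rw [← e1, ← e2]
      exact hs
    refine Runs.seq (runs_rounds hn hq hP hQ he0 hR hs') fun s hs => ?_
    refine (runs_total hs).mono le_rfl fun s hs => ?_
    rw [hs, algorithmOutput_eq_sum hn hP hQ hε he hm (congrFun hR n)]
  refine hmain.mono ?_ fun _ h => h
  have h1 : 1 ≤ n * q := Nat.mul_pos hn hq
  have h2 : m + 1 ≤ n * q * (m + 1) := Nat.le_mul_of_pos_left _ h1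
  have h3 : n * q ≤ n * q * (m + 1) := Nat.le_mul_of_pos_right _ (Nat.succ_pos m)
  have h4 : n ≤ n * q := Nat.le_mul_of_pos_right _ hq
  have h5 : n * (2 + (q * 8 + 1 + 5) + 1) = 8 * (n * q) + 9 * n := by ring
  have h6 : n * (150 * (q * (m + 1)) + 1) = 150 * (n * q * (m + 1)) + n := by ring
  rw [h5, h6]
  omega

/-! ### The number of bins -/

/-- The number of bins is at most proportional to `n / min ε 1 * log (2 * n / (min ε 1 * Δ))`,
where `Δ` lies between the lower bound `d` and `n * d`. -/
theorem numIntervals_add_one_le {n : ℕ} (hn : 0 < n) {ε d Δ : ℝ} (hε : 0 < ε) (hΔ : 0 < Δ)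
    (hΔ1 : Δ ≤ 1) (hd : Δ ≤ n * d) :
    (numIntervals (ε / (2 * n)) (ε / (2 * n) * d) + 1 : ℝ) ≤
      12 * (n / min ε 1 * Real.log (2 * n / (min ε 1 * Δ))) := by
  have hnR : (1 : ℝ) ≤ n := by exact_mod_cast hn
  have hn0 : (0 : ℝ) < n := by linarith
  have hd0 : 0 < d := by
    by_contra h
    have := mul_nonpos_of_nonneg_of_nonpos hn0.le (not_lt.mp h)
    linarith
  set ε' := min ε 1 with hε'
  have h0 : 0 < ε' := lt_min hε one_pos
  have h1 : ε' ≤ 1 := min_le_right _ _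
  have hle : ε' ≤ ε := min_le_left _ _
  set x := 2 * (n : ℝ) / (ε' * Δ) with hx
  set L := Real.log x with hL
  have hεΔ : 0 < ε' * Δ := mul_pos h0 hΔ
  have hεΔ1 : ε' * Δ ≤ 1 := mul_le_one₀ h1 hΔ.le hΔ1
  have hx2 : 2 ≤ x := by
    rw [hx, le_div_iff₀ hεΔ]
    nlinarith
  have hLlow : (0.69 : ℝ) ≤ L := by
    have h2 := Real.log_le_log two_pos hx2
    have h3 := Real.log_two_gt_d9
    linarith
  have hLpos : 0 < L := by linarith
  have hnε : 1 ≤ n / ε' := by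
    rw [le_div_iff₀ h0]
    linarith
  -- `log (1 / δ) ≤ 2 * L`, because `1 / δ ≤ 2 * n ^ 2 / (ε' * Δ) ≤ x ^ 2`.
  have hδ : 0 < ε / (2 * n) * d := by positivity
  have hnum : -Real.log (ε / (2 * n) * d) ≤ 2 * L := by
    rw [← Real.log_inv, hL, ← Real.log_rpow (by linarith)]
    refine Real.log_le_log (inv_pos.mpr hδ) ?_
    rw [inv_le_iff_one_le_mul₀ hδ]
    have e1 : x ^ (2 : ℝ) = x ^ 2 := by norm_cast
    have h3 : 1 ≤ x * (ε / (2 * n) * (Δ / n)) * n := by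
      have : x * (ε / (2 * n) * (Δ / n)) * n = ε / ε' := by
        rw [hx]
        field_simp
      rw [this, le_div_iff₀ h0]
      linarith
    have h4 : (n : ℝ) ≤ x := by
      rw [hx, le_div_iff₀ hεΔ]
      nlinarith
    have h5 : Δ / n ≤ d := by
      rw [div_le_iff₀ hn0]
      linarith
    rw [e1]
    calc (1 : ℝ) ≤ x * (ε / (2 * n) * (Δ / n)) * n := h3
      _ ≤ x * (ε / (2 * n) * d) * x := by gcongr
      _ = x ^ 2 * (ε / (2 * n) * d) := by ring
  -- `log (1 + y) ≥ y / (1 + y) ≥ y / 2` for `y = ε' / (2 * n) ≤ 1`.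
  have hden : ε' / (4 * n) ≤ Real.log (1 + ε / (2 * n)) := by
    have hy0 : 0 < ε' / (2 * n) := by positivity
    have hy1 : ε' / (2 * n) ≤ 1 := by
      rw [div_le_one (by positivity)]
      linarith
    have h2 : 1 + ε' / (2 * n) ≤ 1 + ε / (2 * n) := by gcongr
    have h3 := Real.log_le_log (by positivity) h2
    have h4 := Real.one_sub_inv_le_log_of_pos (show 0 < 1 + ε' / (2 * n) by positivity)
    have h5 : ε' / (4 * n) = ε' / (2 * n) / 2 := by
      field_simp
      norm_num
    have h6 : ε' / (2 * n) / 2 ≤ 1 - (1 + ε' / (2 * n))⁻¹ := by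
      have : 1 - (1 + ε' / (2 * n))⁻¹ = ε' / (2 * n) / (1 + ε' / (2 * n)) := by
        field_simp
        ring
      rw [this]
      gcongr
      linarith
    linarith
  have hden0 : 0 < ε' / (4 * n) := by positivity
  have hquot : -Real.log (ε / (2 * n) * d) / Real.log (1 + ε / (2 * n)) ≤ 8 * (n / ε' * L) := by
    rw [div_le_iff₀ (hden0.trans_le hden)]
    have h2 : 8 * (n / ε' * L) * (ε' / (4 * n)) = 2 * L := by
      field_simp
      norm_num
    have h3 : 0 ≤ 8 * (n / ε' * L) := by positivity
    have h4 := mul_le_mul_of_nonneg_left hden h3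
    linarith
  have hnonneg : 0 ≤ 8 * (n / ε' * L) := by positivity
  have hceil : (numIntervals (ε / (2 * n)) (ε / (2 * n) * d) : ℝ) ≤ 8 * (n / ε' * L) + 1 := by
    rw [numIntervals]
    exact (Nat.cast_le.mpr (Nat.ceil_mono hquot)).trans (Nat.ceil_lt_add_one hnonneg).le
  have h2 : L ≤ n / ε' * L := le_mul_of_one_le_left hLpos.le hnε
  linarith

/-- Two different distributions exist only on at least two points. -/
theorem two_le_of_tvDist_pos {n q : ℕ} {P Q : Fin n → Fin q → ℝ}
    (hP : ∀ i, P i ∈ stdSimplex ℝ (Fin q)) (hQ : ∀ i, Q i ∈ stdSimplex ℝ (Fin q)) (hq : 0 < q)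
    (h : 0 < tvDist (prodDist P) (prodDist Q)) : 2 ≤ q := by
  by_contra hlt
  obtain rfl : q = 1 := by omega
  have : P = Q := by
    funext i j
    have h1 := (hP i).2
    have h2 := (hQ i).2
    rw [Fin.sum_univ_one] at h1 h2
    rw [Subsingleton.elim j 0, h1, h2]
  simp [this, tvDist] at h

end

end TVProduct

theorem mainTheorem1 :
    ∃ (prog : TVProduct.Program) (C : ℝ),
      ∀ (n q : ℕ) (hn : 0 < n) (P Q : Fin n → Fin q → ℝ) (ε : ℝ),
        (∀ i, P i ∈ stdSimplex ℝ (Fin q)) → (∀ i, Q i ∈ stdSimplex ℝ (Fin q)) → 0 < ε →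
        ∃ (T : ℕ) (s : TVProduct.State),
          TVProduct.Exec prog (TVProduct.inputState P Q ε) T s ∧
          s.output = TVProduct.algorithmOutput hn P Q ε ∧
          (1 - ε) * TVProduct.tvDist (TVProduct.prodDist P) (TVProduct.prodDist Q) ≤ s.output ∧
          s.output ≤ TVProduct.tvDist (TVProduct.prodDist P) (TVProduct.prodDist Q) ∧
          (0 < TVProduct.tvDist (TVProduct.prodDist P) (TVProduct.prodDist Q) →
            (T : ℝ) ≤ C * ((q : ℝ) * (n : ℝ) ^ 2 / min ε 1 * Real.log q *
              Real.log (2 * n / (min ε 1 *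
                TVProduct.tvDist (TVProduct.prodDist P) (TVProduct.prodDist Q))))) := by
  refine ⟨TVProduct.program, 6000, fun n q hn P Q ε hP hQ hε => ?_⟩
  have hq : 0 < q := by
    rcases Nat.eq_zero_or_pos q with rfl | h
    · have := (hP ⟨0, hn⟩).2
      simp at this
    · exact h
  obtain ⟨T, s, hexec, hT, hout⟩ := TVProduct.runs_program hn hq hP hQ hε
  obtain ⟨hlow, hup⟩ := TVProduct.algorithmOutput_bounds hn hP hQ hε
  rw [← hout] at hlow hup
  refine ⟨T, s, hexec, hout, hlow, hup, fun hΔ => ?_⟩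
  set Δ := TVProduct.tvDist (TVProduct.prodDist P) (TVProduct.prodDist Q) with hΔdef
  have hΔ1 : Δ ≤ 1 := TVProduct.tvDist_prodDist_le_one hP hQ hn
  have hbins := TVProduct.numIntervals_add_one_le hn hε hΔ hΔ1
    (TVProduct.le_mul_lowerBound hP hQ hn)
  have hlogq : (1 : ℝ) / 2 ≤ Real.log q := by
    have h2 : (2 : ℝ) ≤ q := by exact_mod_cast TVProduct.two_le_of_tvDist_pos hP hQ hq hΔ
    have h3 := Real.log_le_log two_pos h2
    have h4 := Real.log_two_gt_d9
    linarith
  have hT' : (T : ℝ) ≤ 250 * (n * q * (TVProduct.numIntervals (ε / (2 * n))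
      (ε / (2 * n) * TVProduct.lowerBound P Q) + 1)) := by
    exact_mod_cast hT
  set X := n / min ε 1 * Real.log (2 * n / (min ε 1 * Δ)) with hX
  have hX0 : 0 ≤ X := by
    have : (0 : ℝ) ≤ TVProduct.numIntervals (ε / (2 * n))
      (ε / (2 * n) * TVProduct.lowerBound P Q) := Nat.cast_nonneg _
    linarith
  have hnq : (0 : ℝ) ≤ n * q := by positivity
  calc (T : ℝ) ≤ 250 * (n * q * (12 * X)) := hT'.trans (by gcongr)
    _ = 6000 * (n * q * X * (1 / 2)) := by ring
    _ ≤ 6000 * (n * q * X * Real.log q) := by gcongr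
    _ = _ := by rw [hX]; ring
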